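/- There is a universal constant $C>0$ with the following property. Let $L$ be a number of layers, let $d_1^0,d_1^1,\dots,d_1^L$ be widths ($d_1^0$ is the input dimension), and let $d_2^l=d_1^{l-1}$. Let $d>0$ and $\Psi>0$. The weight matrices $\mathbf A^l\in\mathbb R^{d_1^l\times d_2^l}$, $l=1,\dots,L$, have entries that are i.i.d. $\mathcal N(0,\Psi)$ (over all entries of all layers). Given the weights, the pruned matrices $\hat{\mathbf A}^l$ are obtained by setting each off-diagonal entry $\mathbf A^l_{ij}$, $i\ne j$, independently to $0$ with probability $\exp(-(\mathbf A^l_{ij})^2/(d\Psi))$ and keeping it otherwise; diagonal entries are kept. Let $\phi_1,\dots,\phi_{L-1}$ be activation maps on $\mathbb R^{d_1^1},\dots,\mathbb R^{d_1^{L-1}}$ such that $\phi_l$ is $L_l$-Lipschitz for the Euclidean norm and $\phi_l(0)=0$; the output layer has no activation, and $L_L\ge 1$ is any Lipschitz constant of the identity. For an input $x$ put $x^0=x$, $x^1=\mathbf A^1x$, $x^{l+1}=\mathbf A^{l+1}\phi_l(x^l)$, and let $\hat x^l$ be the same with $\hat{\mathbf A}^l$ in place of $\mathbf A^l$. Let $\|\cdot\|_2$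 be the Euclidean norm of vectors and the spectral norm of matrices, and $$\Gamma_l=C\left[\sqrt{\frac{d^{3/2}\Psi}{(d+2)^{3/2}}}\left(\sqrt{d_1^l}+\sqrt{d_2^l}\right)+\left(\frac{3d_1^ld_2^ld^{5/2}\Psi^2}{(d+2)^{5/2}}\right)^{1/4}\right].$$ Let $\epsilon_1,\dots,\epsilon_L>0$, and consider the bound $$\|\hat x^L-x^L\|_2\le e\,d_1^0\left(\prod_{l=1}^L L_l\|\mathbf A^l\|_2\right)\sum_{l=1}^L\frac{\epsilon_l\Gamma_l}{\|\mathbf A^l\|_2}.\qquad(*)$$ (a) For every input $x$ with $\|x\|_2\le d_1^0$, the bound $(*)$ holds with probability at least $1-\sum_{l=1}^L\epsilon_l^{-1}$ over the weights and the pruning. (b) With probability at least $1-\sum_{l=1}^L\epsilon_l^{-1}$, the following holds: if $\epsilon_l\Gamma_l\le\frac1L\|\mathbf A^l\|_2$ for all $l$, then $(*)$ holds simultaneously for all inputs $x$ with $\|x\|_2\le d_1^0$. -/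

import Mathlib

open MeasureTheory ProbabilityTheory
open scoped NNReal ENNReal unitInterval

noncomputable section

namespace MBP

/-- Vectors of length `m` with the Euclidean norm. -/
abbrev Vec (m : ℕ) : Type := EuclideanSpace ℝ (Fin m)

/-- Positions of all the scalar weights of a network with `L` layers and widths `n 0, …, n L`
(`n 0` is the input dimension).  The `l`-th matrix (`l = 0, …, L - 1`) has `n (l + 1)` rows and
`n l` columns. -/
abbrev Entry (L : ℕ) (n : ℕ → ℕ) : Type := Σ l : Fin L, Fin (n (l + 1)) × Fin (n l)

/-- A choice of all the weights. -/
abbrev Weights (L : ℕ) (n : ℕ → ℕ) : Type := Entry L n → ℝ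

/-- The outcomes of the coin flips of the pruning algorithm, one for each weight. -/
abbrev Coins (L : ℕ) (n : ℕ → ℕ) : Type := Entry L n → Bool

variable {L : ℕ} {n : ℕ → ℕ}

/-- The weight matrix of layer `l`. -/
def layer (w : Weights L n) (l : Fin L) : Matrix (Fin (n (l + 1))) (Fin (n l)) ℝ :=
  Matrix.of fun i j => w ⟨l, (i, j)⟩

/-- The spectral norm, i.e. the operator norm with respect to the Euclidean norms. -/
def specNorm {p q : ℕ} (A : Matrix (Fin p) (Fin q) ℝ) : ℝ :=
  ‖LinearMap.toContinuousLinearMap (Matrix.toEuclideanLin A)‖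

/-- The vectors `x⁰ = x`, `x¹ = A₁ x`, `xˡ⁺¹ = Aₗ₊₁ φₗ(xˡ)`.  Layers and activations are indexed from
`0` here, so `φ l` is applied to the output of the matrix `layer w l`; the last activation is never
used. -/
def forward (w : Weights L n) (φ : ∀ l : Fin L, Vec (n (l + 1)) → Vec (n (l + 1)))
    (x : Vec (n 0)) : ∀ l : ℕ, l ≤ L → Vec (n l)
  | 0, _ => x
  | 1, h => Matrix.toEuclideanLin (layer w ⟨0, h⟩) x
  | l + 2, h =>
      Matrix.toEuclideanLin (layer w ⟨l + 1, h⟩)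
        (φ ⟨l, Nat.lt_of_succ_lt h⟩ (forward w φ x (l + 1) (Nat.le_of_succ_le h)))

/-- The output `A_L φ_{L-1}(A_{L-1} φ_{L-2}(⋯ φ₁(A₁ x)))` of the network. -/
def output (w : Weights L n) (φ : ∀ l : Fin L, Vec (n (l + 1)) → Vec (n (l + 1)))
    (x : Vec (n 0)) : Vec (n L) :=
  forward w φ x L le_rfl

/-- The law of the trained weights: all entries of all layers are i.i.d. `N(0, Ψ)`. -/
def weightLaw (L : ℕ) (n : ℕ → ℕ) (Ψ : ℝ≥0) : Measure (Weights L n) :=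
  Measure.pi fun _ => gaussianReal 0 Ψ

/-- The probability `exp (-a² / (d Ψ))` with which an off-diagonal weight of value `a` is pruned. -/
def pruneProb (d Ψ : ℝ≥0) (a : ℝ) : I :=
  ⟨Real.exp (-a ^ 2 / (d * Ψ)), (Real.exp_pos _).le, Real.exp_le_one_iff.2
    (div_nonpos_of_nonpos_of_nonneg (neg_nonpos.2 (sq_nonneg a)) (mul_nonneg d.2 Ψ.2))⟩

/-- The law of the coins given the weights: independent, the coin of an entry of value `a` being
`true` with probability `pruneProb d Ψ a`. -/
def coinLaw (d Ψ : ℝ≥0) (w : Weights L n) : Measure (Coins L n) :=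
  Measure.pi fun e => bernoulliMeasure true false (pruneProb d Ψ (w e))

lemma measurable_pruneProb (d Ψ : ℝ≥0) : Measurable (pruneProb d Ψ) := by
  unfold pruneProb
  exact Measurable.subtype_mk (by fun_prop)

lemma measurable_bernoulli_pruneProb (d Ψ : ℝ≥0) :
    Measurable fun a : ℝ => bernoulliMeasure true false (pruneProb d Ψ a) := by
  refine Measure.measurable_of_measurable_coe _ fun s hs => ?_
  classical
  have h := measurable_pruneProb d Ψ
  have h1 : Measurable fun a => (unitInterval.toNNReal (pruneProb d Ψ a) : ℝ≥0∞) :=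
    (unitInterval.toNNReal_continuous.measurable.comp h).coe_nnreal_ennreal
  have h2 : Measurable fun a => (unitInterval.toNNReal (σ (pruneProb d Ψ a)) : ℝ≥0∞) :=
    (unitInterval.toNNReal_continuous.measurable.comp
      (unitInterval.continuous_symm.measurable.comp h)).coe_nnreal_ennreal
  simp only [bernoulliMeasure_apply _ hs]
  split_ifs <;> first | exact measurable_const | exact h1 | exact h2

instance (d Ψ : ℝ≥0) (w : Weights L n) : IsProbabilityMeasure (coinLaw d Ψ w) := by
  unfold coinLaw; infer_instance

lemma measurable_coinLaw (d Ψ : ℝ≥0) : Measurable (coinLaw (L := L) (n := n) d Ψ) := by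
  refine Measurable.measure_of_isPiSystem_of_isProbabilityMeasure generateFrom_pi.symm
    isPiSystem_pi ?_
  rintro _ ⟨s, hs, rfl⟩
  simp only [coinLaw, Measure.pi_pi]
  refine Finset.measurable_prod _ fun e _ => ?_
  have he : MeasurableSet (s e) := hs e (Set.mem_univ e)
  exact (Measure.measurable_coe he).comp
    ((measurable_bernoulli_pruneProb d Ψ).comp (measurable_pi_apply e))

/-- `coinLaw` as a Markov kernel. -/
def coinKernel (L : ℕ) (n : ℕ → ℕ) (d Ψ : ℝ≥0) : Kernel (Weights L n) (Coins L n) where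
  toFun := coinLaw d Ψ
  measurable' := measurable_coinLaw d Ψ

instance (d Ψ : ℝ≥0) : IsMarkovKernel (coinKernel L n d Ψ) :=
  ⟨fun w => inferInstanceAs (IsProbabilityMeasure (coinLaw d Ψ w))⟩

/-- The joint law of the trained weights and of the coins of the pruning algorithm. -/
def jointLaw (L : ℕ) (n : ℕ → ℕ) (d Ψ : ℝ≥0) : Measure (Weights L n × Coins L n) :=
  weightLaw L n Ψ ⊗ₘ coinKernel L n d Ψ

/-- The result of magnitude-based pruning: an off-diagonal entry is set to `0` if its coin is
`true`; all other entries, in particular the diagonal ones, are kept. -/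
def prune (w : Weights L n) (X : Coins L n) : Weights L n := fun e =>
  if (e.2.1 : ℕ) ≠ (e.2.2 : ℕ) ∧ X e = true then 0 else w e

/-- `Γ` for a layer with a `d₁ × d₂` matrix. -/
def Gam (C : ℝ) (d Ψ : ℝ≥0) (d₁ d₂ : ℕ) : ℝ :=
  C * (Real.sqrt ((d : ℝ) ^ (3 / 2 : ℝ) * Ψ / ((d : ℝ) + 2) ^ (3 / 2 : ℝ)) *
        (Real.sqrt d₁ + Real.sqrt d₂) +
      (3 * d₁ * d₂ * (d : ℝ) ^ (5 / 2 : ℝ) * (Ψ : ℝ) ^ 2 / ((d : ℝ) + 2) ^ (5 / 2 : ℝ)) ^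
        (1 / 4 : ℝ))

/-- The bound `e d₁⁰ (∏ₗ Lₗ ‖Aˡ‖₂) ∑ₗ εₗ Γₗ / ‖Aˡ‖₂`, with `d₁⁰ = n 0` the input dimension. -/
def errorBound (C : ℝ) (d Ψ : ℝ≥0) (ε : Fin L → ℝ) (Lip : Fin L → ℝ≥0) (w : Weights L n) : ℝ :=
  Real.exp 1 * (n 0 : ℝ) * (∏ l : Fin L, (Lip l : ℝ) * specNorm (layer w l)) *
    ∑ l : Fin L, ε l * Gam C d Ψ (n (l + 1)) (n l) / specNorm (layer w l)

end MBP

end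

/-!
Given that an entry of variance `Ψ` is pruned, it is centred Gaussian with variance `dΨ / (d + 2)`,
and it is pruned with probability at most `√(d / (d + 2))`. The matrix `E` of the pruned entries is
thus a Gaussian matrix masked by independent indicators. Its spectral norm `max uᵀ E t` over unit
vectors is bounded by Gaussian smoothing: subtracting from `xᵀ E y` the terms
`dΨ / (2(d + 2)) · xᵢ² yⱼ²` of the pruned positions makes the expectation of the exponential equal
to `1` for every `(x, y)`, hence also on average over a Gaussian `(x, y)`. By the Gibbs variational
inequality, moving the mean of this Gaussian from `0` to the maximiser `(u, t)` costs only a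
relative entropy, and the subtracted terms then depend on the pruned positions only through the
maximal number of them in a row, in a column, and in total, which second moments control. Optimising
over the variance and the scale gives `E‖Eₗ‖ ≤ Γₗ` with `C = 3`.

By Markov's inequality and a union bound, `‖Eₗ‖ ≤ εₗ Γₗ` holds for all layers outside an event of
probability `∑ εₗ⁻¹`. Under the perturbation condition each pruned layer is then at most `1 + 1 / L`
times as large as the original one, and `(1 + 1 / L) ^ L ≤ e` yields (b). For (a) no condition is
available, and the pruned layers may have a larger spectral norm than the original ones. Instead,
the joint law is invariant under flipping the signs of the columns of a layer, the pruned layer is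
entrywise dominated by the original one, and averaging over these signs shows that, on average, a
pruned layer does not stretch its input by more than the spectral norm of the original layer.
-/

namespace MBP

open scoped Matrix.Norms.L2Operator BigOperators

section GaussianVariationalBound

variable {ι κ : Type*} [Fintype ι] [Fintype κ] {v : ℝ≥0}

lemma lintegral_pi_prod {E : ι → Type*} {mE : ∀ i, MeasurableSpace (E i)}
    (μ : ∀ i, Measure (E i)) [∀ i, IsProbabilityMeasure (μ i)] {f : ∀ i, E i → ℝ≥0∞}
    (hf : ∀ i, Measurable (f i)) :
    ∫⁻ x, ∏ i, f i (x i) ∂Measure.pi μ = ∏ i, ∫⁻ x, f i x ∂μ i := by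
  rw [lintegral_prod_eq_prod_lintegral_of_indepFun Finset.univ _
    (iIndepFun_pi fun i => (hf i).aemeasurable) fun i => (hf i).comp (measurable_pi_apply i)]
  exact Finset.prod_congr rfl fun i _ => (measurePreserving_eval μ i).lintegral_comp (hf i)

lemma pi_withDensity {E : ι → Type*} {mE : ∀ i, MeasurableSpace (E i)}
    (μ : ∀ i, Measure (E i)) [∀ i, IsProbabilityMeasure (μ i)] {f : ∀ i, E i → ℝ≥0∞}
    (hf : ∀ i, Measurable (f i)) [∀ i, SigmaFinite ((μ i).withDensity (f i))] :
    (Measure.pi fun i => (μ i).withDensity (f i)) =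
      (Measure.pi μ).withDensity fun x => ∏ i, f i (x i) := by
  refine Measure.pi_eq fun s hs => ?_
  have indicator_prod (x : ∀ i, E i) :
      (Set.univ.pi s).indicator (fun x => ∏ i, f i (x i)) x =
        ∏ i, (s i).indicator (f i) (x i) := by
    classical simp [Set.indicator_apply, Finset.prod_ite_zero]
  rw [withDensity_apply _ (.univ_pi hs), ← lintegral_indicator (.univ_pi hs)]
  simp_rw [indicator_prod]
  rw [lintegral_pi_prod μ fun i => (hf i).indicator (hs i)]
  exact Finset.prod_congr rfl fun i _ => by
    rw [lintegral_indicator (hs i), withDensity_apply _ (hs i)]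

lemma ofReal_exp_integral_le_lintegral {Ω : Type*} [MeasurableSpace Ω] {μ : Measure Ω}
    [IsProbabilityMeasure μ] {g : Ω → ℝ} (hg : Integrable g μ) :
    ENNReal.ofReal (Real.exp (∫ x, g x ∂μ)) ≤ ∫⁻ x, ENNReal.ofReal (Real.exp (g x)) ∂μ := by
  have exp_nonneg : 0 ≤ᵐ[μ] fun x => Real.exp (g x) := .of_forall fun x => (Real.exp_pos _).le
  by_cases htop : ∫⁻ x, ENNReal.ofReal (Real.exp (g x)) ∂μ = ∞
  · simp [htop]
  have hexp : Integrable (fun x => Real.exp (g x)) μ :=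
    ⟨Real.continuous_exp.comp_aestronglyMeasurable hg.1,
      (hasFiniteIntegral_iff_ofReal exp_nonneg).2 (lt_top_iff_ne_top.2 htop)⟩
  rw [← ofReal_integral_eq_lintegral_ofReal hexp exp_nonneg]
  exact ENNReal.ofReal_le_ofReal <| convexOn_exp.map_integral_le
    Real.continuous_exp.continuousOn isClosed_univ (by simp) hg hexp

lemma gaussianReal_zero_eq_withDensity (u : ℝ) (hv : v ≠ 0) :
    gaussianReal 0 v = (gaussianReal u v).withDensity
      fun x => ENNReal.ofReal (Real.exp ((u ^ 2 / 2 - u * x) / v)) := by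
  have hv' : (v : ℝ) ≠ 0 := by exact_mod_cast hv
  rw [gaussianReal_of_var_ne_zero _ hv, gaussianReal_of_var_ne_zero _ hv,
    ← withDensity_mul _ (measurable_gaussianPDF _ _) (by fun_prop)]
  congr 1
  funext x
  simp only [gaussianPDF, gaussianPDFReal, Pi.mul_apply]
  rw [← ENNReal.ofReal_mul (by positivity), mul_assoc (Real.sqrt _)⁻¹, ← Real.exp_add]
  congr 3
  field_simp
  ring

lemma pi_gaussianReal_zero_eq_withDensity (u : ι → ℝ) (hv : v ≠ 0) :
    (Measure.pi fun _ : ι => gaussianReal 0 v) =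
      (Measure.pi fun i => gaussianReal (u i) v).withDensity
        fun x => ENNReal.ofReal (Real.exp (∑ i, (u i ^ 2 / 2 - u i * x i) / v)) := by
  have (i : ι) : SigmaFinite ((gaussianReal (u i) v).withDensity
      fun x => ENNReal.ofReal (Real.exp ((u i ^ 2 / 2 - u i * x) / v))) := by
    rw [← gaussianReal_zero_eq_withDensity (u i) hv]
    infer_instance
  simp_rw [Real.exp_sum, ENNReal.ofReal_prod_of_nonneg fun _ _ => (Real.exp_pos _).le]
  rw [← pi_withDensity (fun i => gaussianReal (u i) v) (f := fun i x =>
    ENNReal.ofReal (Real.exp ((u i ^ 2 / 2 - u i * x) / v))) fun i => by fun_prop]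
  simp_rw [← gaussianReal_zero_eq_withDensity _ hv]

lemma integrable_eval_pi_gaussianReal (u : ι → ℝ) (v : ℝ≥0) (i : ι) :
    Integrable (fun x : ι → ℝ => x i) (Measure.pi fun i => gaussianReal (u i) v) :=
  integrable_comp_eval (μ := fun i => gaussianReal (u i) v)
    ((memLp_id_gaussianReal 1).integrable le_rfl)

lemma integral_eval_pi_gaussianReal (u : ι → ℝ) (v : ℝ≥0) (i : ι) :
    ∫ x : ι → ℝ, x i ∂(Measure.pi fun i => gaussianReal (u i) v) = u i :=
  (integral_comp_eval (μ := fun i => gaussianReal (u i) v)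
    aestronglyMeasurable_id).trans integral_id_gaussianReal

lemma integrable_sq_gaussianReal (u : ℝ) (v : ℝ≥0) :
    Integrable (fun x => x ^ 2) (gaussianReal u v) :=
  (memLp_id_gaussianReal (μ := u) (v := v) 2).integrable_sq

lemma integral_sq_gaussianReal (u : ℝ) (v : ℝ≥0) :
    ∫ x, x ^ 2 ∂gaussianReal u v = u ^ 2 + v := by
  have h := variance_eq_sub (memLp_id_gaussianReal (μ := u) (v := v) 2)
  simp only [variance_id_gaussianReal, Pi.pow_apply, id, integral_id_gaussianReal] at h
  linarith

/-- The Gibbs variational inequality, tested against the translates of a Gaussian measure; the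
quadratic term is the relative entropy of the translate. -/
lemma ofReal_exp_integral_sub_le_lintegral_pi_gaussianReal (hv : v ≠ 0) (u : ι → ℝ)
    {f : (ι → ℝ) → ℝ} (hf : Integrable f (Measure.pi fun i => gaussianReal (u i) v)) :
    ENNReal.ofReal (Real.exp (∫ x, f x ∂(Measure.pi fun i => gaussianReal (u i) v) -
        (∑ i, u i ^ 2) / (2 * v))) ≤
      ∫⁻ x, ENNReal.ofReal (Real.exp (f x)) ∂(Measure.pi fun _ : ι => gaussianReal 0 v) := by
  have hv' : (v : ℝ) ≠ 0 := by exact_mod_cast hv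
  set γ := Measure.pi fun i => gaussianReal (u i) v with hγ
  have integrable_linear (i : ι) : Integrable (fun x : ι → ℝ => u i * x i) γ :=
    (integrable_eval_pi_gaussianReal u v i).const_mul _
  have integrable_term (i : ι) : Integrable (fun x : ι → ℝ => (u i ^ 2 / 2 - u i * x i) / v) γ :=
    ((integrable_const _).sub (integrable_linear i)).div_const _
  have integrable_logDensity :
      Integrable (fun x : ι → ℝ => ∑ i, (u i ^ 2 / 2 - u i * x i) / v) γ :=
    integrable_finsetSum _ fun i _ => integrable_term i
  have integral_logDensity :
      ∫ x : ι → ℝ, ∑ i, (u i ^ 2 / 2 - u i * x i) / v ∂γ = -((∑ i, u i ^ 2) / (2 * v)) := by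
    rw [integral_finsetSum _ fun i _ => integrable_term i, Finset.sum_div,
      ← Finset.sum_neg_distrib]
    refine Finset.sum_congr rfl fun i _ => ?_
    rw [integral_div, integral_sub (integrable_const _) (integrable_linear i), integral_const_mul,
      integral_eval_pi_gaussianReal, integral_const, probReal_univ, one_smul]
    field_simp
    ring
  rw [pi_gaussianReal_zero_eq_withDensity u hv, ← hγ, sub_eq_add_neg, ← integral_logDensity,
    ← integral_add hf integrable_logDensity,
    lintegral_withDensity_eq_lintegral_mul₀ (Measurable.aemeasurable (by fun_prop))
      hf.aemeasurable.exp.ennreal_ofReal]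
  refine (ofReal_exp_integral_le_lintegral (hf.add integrable_logDensity)).trans_eq ?_
  refine lintegral_congr fun x => ?_
  rw [Pi.mul_apply, ← ENNReal.ofReal_mul (Real.exp_pos _).le, ← Real.exp_add, add_comm]
  rfl

lemma integrable_mul_eval_pi_gaussianReal (u : ι → ℝ) (v : ℝ≥0) {f g : ℝ → ℝ} {a b : ι}
    (hab : a ≠ b) (hf : Integrable f (gaussianReal (u a) v))
    (hg : Integrable g (gaussianReal (u b) v)) (hfm : Measurable f) (hgm : Measurable g) :
    Integrable (fun x : ι → ℝ => f (x a) * g (x b)) (Measure.pi fun i => gaussianReal (u i) v) :=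
  (((iIndepFun_pi (X := fun _ x => x) fun _ => aemeasurable_id).indepFun hab).comp
    hfm hgm).integrable_mul (integrable_comp_eval (μ := fun i => gaussianReal (u i) v) hf)
      (integrable_comp_eval (μ := fun i => gaussianReal (u i) v) hg)

lemma integral_mul_eval_pi_gaussianReal (u : ι → ℝ) (v : ℝ≥0) {f g : ℝ → ℝ} {a b : ι}
    (hab : a ≠ b) (hfm : Measurable f) (hgm : Measurable g) :
    ∫ x : ι → ℝ, f (x a) * g (x b) ∂(Measure.pi fun i => gaussianReal (u i) v) =
      (∫ x, f x ∂gaussianReal (u a) v) * ∫ x, g x ∂gaussianReal (u b) v := by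
  rw [((iIndepFun_pi (X := fun _ x => x) fun _ => aemeasurable_id).indepFun
      hab).integral_fun_comp_mul_comp (measurable_pi_apply a).aemeasurable
      (measurable_pi_apply b).aemeasurable hfm.aestronglyMeasurable hgm.aestronglyMeasurable,
    integral_comp_eval (μ := fun i => gaussianReal (u i) v) hfm.aestronglyMeasurable,
    integral_comp_eval (μ := fun i => gaussianReal (u i) v) hgm.aestronglyMeasurable]

lemma ofReal_exp_bilinear_sub_quartic_le_lintegral (A c : ι → κ → ℝ) (hv : v ≠ 0)
    (u : ι → ℝ) (t : κ → ℝ) :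
    ENNReal.ofReal (Real.exp (∑ i, ∑ j, (A i j * (u i * t j) -
        c i j * ((u i ^ 2 + v) * (t j ^ 2 + v))) - (∑ i, u i ^ 2 + ∑ j, t j ^ 2) / (2 * v))) ≤
      ∫⁻ z : ι ⊕ κ → ℝ, ENNReal.ofReal (Real.exp (∑ i, ∑ j, (A i j * (z (.inl i) * z (.inr j)) -
        c i j * (z (.inl i) ^ 2 * z (.inr j) ^ 2)))) ∂(Measure.pi fun _ => gaussianReal 0 v) := by
  set γ := Measure.pi fun a => gaussianReal (Sum.elim u t a) v
  have ne (i : ι) (j : κ) : (Sum.inl i : ι ⊕ κ) ≠ .inr j := Sum.inl_ne_inr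
  have integrable_bilinear (i : ι) (j : κ) :
      Integrable (fun z : ι ⊕ κ → ℝ => A i j * (z (.inl i) * z (.inr j))) γ :=
    (integrable_mul_eval_pi_gaussianReal _ v (ne i j)
      ((memLp_id_gaussianReal 1).integrable le_rfl) ((memLp_id_gaussianReal 1).integrable le_rfl)
      measurable_id measurable_id).const_mul _
  have integrable_quartic (i : ι) (j : κ) :
      Integrable (fun z : ι ⊕ κ → ℝ => c i j * (z (.inl i) ^ 2 * z (.inr j) ^ 2)) γ :=
    (integrable_mul_eval_pi_gaussianReal _ v (ne i j) (integrable_sq_gaussianReal _ v)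
      (integrable_sq_gaussianReal _ v) (by fun_prop) (by fun_prop)).const_mul _
  have integrable_term (i : ι) (j : κ) : Integrable (fun z : ι ⊕ κ → ℝ =>
      A i j * (z (.inl i) * z (.inr j)) - c i j * (z (.inl i) ^ 2 * z (.inr j) ^ 2)) γ :=
    (integrable_bilinear i j).sub (integrable_quartic i j)
  have integrable_row (i : ι) := integrable_finsetSum Finset.univ fun j _ => integrable_term i j
  convert ofReal_exp_integral_sub_le_lintegral_pi_gaussianReal hv (Sum.elim u t)
    (integrable_finsetSum Finset.univ fun i _ => integrable_row i) using 4
  · rw [integral_finsetSum _ fun i _ => integrable_row i]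
    refine Finset.sum_congr rfl fun i _ => ?_
    rw [integral_finsetSum _ fun j _ => integrable_term i j]
    refine Finset.sum_congr rfl fun j _ => ?_
    rw [integral_sub (integrable_bilinear i j) (integrable_quartic i j), integral_const_mul,
      integral_const_mul, integral_mul_eval_pi_gaussianReal _ v (ne i j) measurable_id
        measurable_id (f := fun x => x) (g := fun x => x),
      integral_mul_eval_pi_gaussianReal _ v (ne i j) (f := fun x => x ^ 2) (g := fun x => x ^ 2)
        (by fun_prop) (by fun_prop)]
    simp only [integral_sq_gaussianReal, integral_id_gaussianReal, Sum.elim_inl, Sum.elim_inr]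
  · simp only [Fintype.sum_sum_type, Sum.elim_inl, Sum.elim_inr]

end GaussianVariationalBound

section MaskedSubgaussianMatrix

variable {Ω : Type*} [MeasurableSpace Ω] {μ : Measure Ω}
  {ι κ : Type*} [Fintype ι] [Fintype κ]

lemma exists_l2_opNorm_le_bilinear [DecidableEq κ] (A : Matrix ι κ ℝ) :
    ∃ (u : ι → ℝ) (t : κ → ℝ), ∑ i, u i ^ 2 ≤ 1 ∧ ∑ j, t j ^ 2 ≤ 1 ∧
      ‖A‖ ≤ ∑ i, ∑ j, A i j * (u i * t j) := by
  set T := LinearMap.toContinuousLinearMap (Matrix.toEuclideanLin A) with hT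
  obtain ⟨t, ht, hmax⟩ := (isCompact_closedBall (0 : EuclideanSpace ℝ κ) 1).exists_isMaxOn
    ⟨0, by simp⟩ T.continuous.norm.continuousOn
  have norm_le : ‖A‖ ≤ ‖T t‖ := by
    rw [Matrix.l2_opNorm_def]
    exact T.opNorm_le_of_unit_norm (norm_nonneg _) fun x hx => hmax (by simp [hx])
  have coord (i : ι) : T t i = ∑ j, A i j * t j := by
    simp [hT, Matrix.toLpLin_apply, Matrix.mulVec, dotProduct]
  refine ⟨fun i => ‖T t‖⁻¹ * T t i, t, ?_, ?_, norm_le.trans_eq ?_⟩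
  · simp only [mul_pow, ← Finset.mul_sum, ← EuclideanSpace.real_norm_sq_eq]
    rw [← mul_pow]
    exact pow_le_one₀ (by positivity) (inv_mul_le_one (a := ‖T t‖))
  · rw [← EuclideanSpace.real_norm_sq_eq]
    exact pow_le_one₀ (norm_nonneg t) (by simpa using ht)
  · have bilinear_eq : ∑ i, ∑ j, A i j * (‖T t‖⁻¹ * T t i * t j) = ‖T t‖⁻¹ * ‖T t‖ ^ 2 := by
      rw [EuclideanSpace.real_norm_sq_eq, Finset.mul_sum]
      refine Finset.sum_congr rfl fun i _ => ?_
      rw [show ‖T t‖⁻¹ * T t i ^ 2 = ‖T t‖⁻¹ * T t i * ∑ j, A i j * t j by rw [← coord]; ring,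
        Finset.mul_sum]
      exact Finset.sum_congr rfl fun j _ => by ring
    rw [bilinear_eq, sq, ← mul_assoc]
    rcases eq_or_ne ‖T t‖ 0 with h | h <;> simp [h]

/-- The entries of the random matrix `A` behave like independent centred sub-Gaussian variables of
variance proxy `s * m i j`, where the mask `m` is itself random: the moment generating function of
every rank-one linear functional of `A` is compensated by the mask. -/
structure HasMaskedSubgaussianMGF (A m : Ω → Matrix ι κ ℝ) (s : ℝ) (μ : Measure Ω) : Prop where
  measurable_entry : ∀ i j, Measurable fun ω => A ω i j
  measurable_mask : ∀ i j, Measurable fun ω => m ω i j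
  lintegral_exp_le_one : ∀ (x : ι → ℝ) (y : κ → ℝ),
    ∫⁻ ω, ENNReal.ofReal (Real.exp (∑ i, ∑ j, (A ω i j * (x i * y j) -
      s / 2 * m ω i j * (x i ^ 2 * y j ^ 2)))) ∂μ ≤ 1

lemma HasMaskedSubgaussianMGF.const_smul {A m : Ω → Matrix ι κ ℝ} {s : ℝ}
    (h : HasMaskedSubgaussianMGF A m s μ) (c : ℝ) :
    HasMaskedSubgaussianMGF (fun ω => c • A ω) m (c ^ 2 * s) μ where
  measurable_entry i j := (h.measurable_entry i j).const_mul c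
  measurable_mask := h.measurable_mask
  lintegral_exp_le_one x y := by
    convert h.lintegral_exp_le_one (c • x) y using 7
    simp only [Matrix.smul_apply, Pi.smul_apply, smul_eq_mul]
    ring

lemma HasMaskedSubgaussianMGF.lintegral_gaussian_le_one [IsFiniteMeasure μ]
    {A m : Ω → Matrix ι κ ℝ} {s : ℝ} (h : HasMaskedSubgaussianMGF A m s μ) (v : ℝ≥0) :
    ∫⁻ ω, ∫⁻ z : ι ⊕ κ → ℝ, ENNReal.ofReal (Real.exp (∑ i, ∑ j,
      (A ω i j * (z (.inl i) * z (.inr j)) -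
        s / 2 * m ω i j * (z (.inl i) ^ 2 * z (.inr j) ^ 2))))
      ∂(Measure.pi fun _ => gaussianReal 0 v) ∂μ ≤ 1 := by
  have hA := h.measurable_entry
  have hm := h.measurable_mask
  have measurable_exponent : Measurable fun q : Ω × (ι ⊕ κ → ℝ) => ∑ i, ∑ j,
      (A q.1 i j * (q.2 (.inl i) * q.2 (.inr j)) -
        s / 2 * m q.1 i j * (q.2 (.inl i) ^ 2 * q.2 (.inr j) ^ 2)) := by
    fun_prop
  calc _ = _ := lintegral_lintegral_swap
        (Real.measurable_exp.comp measurable_exponent).ennreal_ofReal.aemeasurable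
    _ ≤ ∫⁻ _z : ι ⊕ κ → ℝ, 1 ∂(Measure.pi fun _ => gaussianReal 0 v) := lintegral_mono fun z =>
        h.lintegral_exp_le_one (fun i => z (.inl i)) fun j => z (.inr j)
    _ = 1 := by rw [lintegral_one, measure_univ]

lemma sum_mul_sq_add_mul_sq_add_le {m : ι → κ → ℝ} (hm : ∀ i j, m i j ≤ 1) {v D₁ D₂ : ℝ}
    (hv : 0 ≤ v) (hD₁ : 0 ≤ D₁) (hD₂ : 0 ≤ D₂) (hrow : ∀ i, ∑ j, m i j ≤ D₁)
    (hcol : ∀ j, ∑ i, m i j ≤ D₂) {u : ι → ℝ} {t : κ → ℝ} (hu : ∑ i, u i ^ 2 ≤ 1)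
    (ht : ∑ j, t j ^ 2 ≤ 1) :
    ∑ i, ∑ j, m i j * ((u i ^ 2 + v) * (t j ^ 2 + v)) ≤
      1 + v * D₁ + v * D₂ + v ^ 2 * ∑ i, ∑ j, m i j := by
  have quartic : ∑ i, ∑ j, m i j * (u i ^ 2 * t j ^ 2) ≤ 1 := by
    calc _ ≤ ∑ i, ∑ j, u i ^ 2 * t j ^ 2 := by
          refine Finset.sum_le_sum fun i _ => Finset.sum_le_sum fun j _ => ?_
          exact mul_le_of_le_one_left (by positivity) (hm i j)
      _ = (∑ i, u i ^ 2) * ∑ j, t j ^ 2 := (Finset.sum_mul_sum _ _ _ _).symm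
      _ ≤ 1 := mul_le_one₀ hu (Finset.sum_nonneg fun j _ => sq_nonneg _) ht
  have rows : ∑ i, u i ^ 2 * ∑ j, m i j ≤ D₁ := by
    calc _ ≤ ∑ i, u i ^ 2 * D₁ := by gcongr with i _; exact hrow i
      _ = (∑ i, u i ^ 2) * D₁ := (Finset.sum_mul _ _ _).symm
      _ ≤ D₁ := mul_le_of_le_one_left hD₁ hu
  have cols : ∑ j, t j ^ 2 * ∑ i, m i j ≤ D₂ := by
    calc _ ≤ ∑ j, t j ^ 2 * D₂ := by gcongr with j _; exact hcol j
      _ = (∑ j, t j ^ 2) * D₂ := (Finset.sum_mul _ _ _).symm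
      _ ≤ D₂ := mul_le_of_le_one_left hD₂ ht
  have expand : ∑ i, ∑ j, m i j * ((u i ^ 2 + v) * (t j ^ 2 + v)) =
      ∑ i, ∑ j, m i j * (u i ^ 2 * t j ^ 2) + v * ∑ i, u i ^ 2 * ∑ j, m i j +
        v * ∑ j, t j ^ 2 * ∑ i, m i j + v ^ 2 * ∑ i, ∑ j, m i j := by
    have swap : ∑ j, t j ^ 2 * ∑ i, m i j = ∑ i, ∑ j, t j ^ 2 * m i j := by
      simp_rw [Finset.mul_sum]
      exact Finset.sum_comm
    simp_rw [swap, Finset.mul_sum, ← Finset.sum_add_distrib]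
    exact Finset.sum_congr rfl fun i _ => Finset.sum_congr rfl fun j _ => by ring
  rw [expand]
  gcongr

lemma ofReal_exp_l2_opNorm_sub_le_lintegral [DecidableEq κ] (A : Matrix ι κ ℝ) {m : ι → κ → ℝ}
    (hm : ∀ i j, m i j ≤ 1) {v : ℝ≥0} (hv : v ≠ 0) {s D₁ D₂ : ℝ} (hs : 0 ≤ s) (hD₁ : 0 ≤ D₁)
    (hD₂ : 0 ≤ D₂) (hrow : ∀ i, ∑ j, m i j ≤ D₁) (hcol : ∀ j, ∑ i, m i j ≤ D₂) :
    ENNReal.ofReal (Real.exp (‖A‖ -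
        (s / 2 * (1 + v * D₁ + v * D₂ + v ^ 2 * ∑ i, ∑ j, m i j) + (v : ℝ)⁻¹))) ≤
      ∫⁻ z : ι ⊕ κ → ℝ, ENNReal.ofReal (Real.exp (∑ i, ∑ j,
        (A i j * (z (.inl i) * z (.inr j)) -
          s / 2 * m i j * (z (.inl i) ^ 2 * z (.inr j) ^ 2))))
        ∂(Measure.pi fun _ => gaussianReal 0 v) := by
  obtain ⟨u, t, hu, ht, hA⟩ := exists_l2_opNorm_le_bilinear A
  refine le_trans (ENNReal.ofReal_le_ofReal (Real.exp_le_exp.2 ?_))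
    (ofReal_exp_bilinear_sub_quartic_le_lintegral A (fun i j => s / 2 * m i j) hv u t)
  have weight := mul_le_mul_of_nonneg_left
    (sum_mul_sq_add_mul_sq_add_le hm v.coe_nonneg hD₁ hD₂ hrow hcol hu ht)
    (show 0 ≤ s / 2 by positivity)
  have entropy : (∑ i, u i ^ 2 + ∑ j, t j ^ 2) / (2 * v) ≤ (v : ℝ)⁻¹ := by
    rw [inv_eq_one_div, ← mul_div_mul_left (1 : ℝ) (v : ℝ) two_ne_zero]
    gcongr
    linarith
  simp_rw [mul_assoc (s / 2), Finset.sum_sub_distrib, ← Finset.mul_sum]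
  linarith

lemma exists_integrable_ge_of_sum_variance_le [IsProbabilityMeasure μ] {R : ι → Ω → ℝ}
    (hR : ∀ i, MemLp (R i) 2 μ) {c r : ℝ} (hc : 0 ≤ c) (hr : 0 < r) (hmean : ∀ i, μ[R i] ≤ c)
    (hvar : ∑ i, Var[R i; μ] ≤ r ^ 2) :
    ∃ D : Ω → ℝ, Integrable D μ ∧ (∀ ω, 0 ≤ D ω) ∧ (∀ i ω, R i ω ≤ D ω) ∧ μ[D] ≤ c + r := by
  have integrable_dev (i : ι) : Integrable (fun ω => (R i ω - μ[R i]) ^ 2) μ :=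
    ((hR i).sub (memLp_const _)).integrable_sq
  have integrable_devs := integrable_finsetSum Finset.univ fun i _ => integrable_dev i
  -- AM-GM bounds each deviation by `r / 2` plus its square divided by `2 * r`
  refine ⟨fun ω => c + r / 2 + (∑ i, (R i ω - μ[R i]) ^ 2) / (2 * r),
    (integrable_const _).add (integrable_devs.div_const _), fun ω => by positivity,
    fun i ω => ?_, ?_⟩
  · have dev_le : R i ω - μ[R i] ≤ r / 2 + (R i ω - μ[R i]) ^ 2 / (2 * r) := by
      rw [← sub_nonneg, show r / 2 + (R i ω - μ[R i]) ^ 2 / (2 * r) - (R i ω - μ[R i]) =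
        (r - (R i ω - μ[R i])) ^ 2 / (2 * r) by field_simp; ring]
      positivity
    have single_le : (R i ω - μ[R i]) ^ 2 / (2 * r) ≤
        (∑ k, (R k ω - μ[R k]) ^ 2) / (2 * r) := by
      gcongr
      exact Finset.single_le_sum (f := fun k => (R k ω - μ[R k]) ^ 2)
        (fun _ _ => sq_nonneg _) (Finset.mem_univ i)
    linarith [hmean i]
  · rw [integral_add (integrable_const _) (integrable_devs.div_const _), integral_div,
      integral_finsetSum _ fun i _ => integrable_dev i]
    simp_rw [← variance_eq_integral (hR _).aemeasurable]
    rw [integral_const, probReal_univ, one_smul]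
    have : (∑ i, Var[R i; μ]) / (2 * r) ≤ r / 2 := by
      rw [div_le_div_iff₀ (by positivity) two_pos]
      linarith
    linarith

lemma variance_sum_le_of_pairwise_indepFun [IsProbabilityMeasure μ] {X : ι → Ω → ℝ}
    (hX : ∀ i, AEMeasurable (X i) μ) (hmem : ∀ i ω, X i ω ∈ Set.Icc 0 1)
    (hindep : Pairwise fun i j => IndepFun (X i) (X j) μ) {p : ℝ} (hp : ∀ i, μ[X i] ≤ p) :
    Var[fun ω => ∑ i, X i ω; μ] ≤ Fintype.card ι * p := by
  have memLp (i : ι) : MemLp (X i) 2 μ :=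
    memLp_of_bounded (.of_forall (hmem i)) (hX i).aestronglyMeasurable 2
  have variance_le (i : ι) : Var[X i; μ] ≤ p := by
    refine (variance_le_expectation_sq (memLp i).1).trans ((integral_mono (memLp i).integrable_sq
      ((memLp i).integrable one_le_two) fun ω => ?_).trans (hp i))
    exact pow_le_of_le_one (hmem i ω).1 (hmem i ω).2 two_ne_zero
  calc Var[fun ω => ∑ i, X i ω; μ] = Var[∑ i, X i; μ] := by
        congr 1
        ext ω
        exact (Finset.sum_apply ω _ X).symm
    _ = ∑ i, Var[X i; μ] :=
        IndepFun.variance_sum (fun i _ => memLp i) fun i _ j _ hij => hindep hij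
    _ ≤ ∑ _i : ι, p := Finset.sum_le_sum fun i _ => variance_le i
    _ = Fintype.card ι * p := by simp

lemma exists_integrable_ge_row_sums [IsProbabilityMeasure μ] {X : ι → κ → Ω → ℝ}
    (hX : ∀ i j, AEMeasurable (X i j) μ) (hmem : ∀ i j ω, X i j ω ∈ Set.Icc 0 1)
    (hindep : ∀ i, Pairwise fun j j' => IndepFun (X i j) (X i j') μ) {p r : ℝ} (hp : 0 ≤ p)
    (hmean : ∀ i j, μ[X i j] ≤ p) (hr : 0 < r)
    (hr2 : Fintype.card ι * Fintype.card κ * p ≤ r ^ 2) :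
    ∃ D : Ω → ℝ, Integrable D μ ∧ (∀ ω, 0 ≤ D ω) ∧ (∀ i ω, ∑ j, X i j ω ≤ D ω) ∧
      μ[D] ≤ Fintype.card κ * p + r := by
  have memLp (i : ι) (j : κ) : MemLp (X i j) 2 μ :=
    memLp_of_bounded (.of_forall (hmem i j)) (hX i j).aestronglyMeasurable 2
  refine exists_integrable_ge_of_sum_variance_le (R := fun i ω => ∑ j, X i j ω)
    (fun i => memLp_finsetSum _ fun j _ => memLp i j) (by positivity) hr (fun i => ?_) ?_
  · rw [integral_finsetSum _ fun j _ => (memLp i j).integrable one_le_two]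
    exact (Finset.sum_le_sum fun j _ => hmean i j).trans_eq (by simp)
  · calc ∑ i, Var[fun ω => ∑ j, X i j ω; μ]
        ≤ ∑ _i : ι, Fintype.card κ * p := Finset.sum_le_sum fun i _ =>
          variance_sum_le_of_pairwise_indepFun (hX i) (hmem i) (hindep i) (hmean i)
      _ = Fintype.card ι * Fintype.card κ * p := by simp [mul_assoc]
      _ ≤ r ^ 2 := hr2

end MaskedSubgaussianMatrix

section ExpectedOpNorm

variable {Ω : Type*} [MeasurableSpace Ω] {μ : Measure Ω} [IsProbabilityMeasure μ]
  {ι κ : Type*} [Fintype ι] [Fintype κ] [DecidableEq κ] {A m : Ω → Matrix ι κ ℝ} {s p : ℝ}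

lemma HasMaskedSubgaussianMGF.lintegral_l2_opNorm_le_lintegral
    (h : HasMaskedSubgaussianMGF A m s μ) (hm : ∀ i j ω, m ω i j ≤ 1) (hs : 0 ≤ s)
    {v : ℝ≥0} (hv : v ≠ 0) {D₁ D₂ : Ω → ℝ} (hD₁m : AEMeasurable D₁ μ) (hD₂m : AEMeasurable D₂ μ)
    (hD₁ : ∀ ω, 0 ≤ D₁ ω) (hD₂ : ∀ ω, 0 ≤ D₂ ω) (hrow : ∀ i ω, ∑ j, m ω i j ≤ D₁ ω)
    (hcol : ∀ j ω, ∑ i, m ω i j ≤ D₂ ω) :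
    ∫⁻ ω, ENNReal.ofReal ‖A ω‖ ∂μ ≤ ∫⁻ ω, ENNReal.ofReal (s / 2 *
      (1 + v * D₁ ω + v * D₂ ω + v ^ 2 * ∑ i, ∑ j, m ω i j) + (v : ℝ)⁻¹) ∂μ := by
  set K : Ω → ℝ := fun ω =>
    s / 2 * (1 + v * D₁ ω + v * D₂ ω + v ^ 2 * ∑ i, ∑ j, m ω i j) + (v : ℝ)⁻¹
  have hmm := h.measurable_mask
  have measurable_K : AEMeasurable K μ := by fun_prop
  have lintegral_exp_le : ∫⁻ ω, ENNReal.ofReal (Real.exp (‖A ω‖ - K ω)) ∂μ ≤ 1 :=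
    (lintegral_mono fun ω => ofReal_exp_l2_opNorm_sub_le_lintegral (A ω) (fun i j => hm i j ω) hv
      hs (hD₁ ω) (hD₂ ω) (fun i => hrow i ω) fun j => hcol j ω).trans
      (h.lintegral_gaussian_le_one v)
  refine (ENNReal.add_le_add_iff_right ENNReal.one_ne_top).1 ?_
  calc ∫⁻ ω, ENNReal.ofReal ‖A ω‖ ∂μ + 1
      = ∫⁻ ω, (ENNReal.ofReal ‖A ω‖ + 1) ∂μ := by
        rw [lintegral_add_right _ measurable_const, lintegral_one, measure_univ]
    _ ≤ ∫⁻ ω, (ENNReal.ofReal (Real.exp (‖A ω‖ - K ω)) + ENNReal.ofReal (K ω)) ∂μ := by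
        refine lintegral_mono fun ω => ?_
        rw [← ENNReal.ofReal_one, ← ENNReal.ofReal_add (norm_nonneg _) zero_le_one]
        refine (ENNReal.ofReal_le_ofReal ?_).trans ENNReal.ofReal_add_le
        linarith [Real.add_one_le_exp (‖A ω‖ - K ω)]
    _ = ∫⁻ ω, ENNReal.ofReal (Real.exp (‖A ω‖ - K ω)) ∂μ + ∫⁻ ω, ENNReal.ofReal (K ω) ∂μ :=
        lintegral_add_right' _ measurable_K.ennreal_ofReal
    _ ≤ ∫⁻ ω, ENNReal.ofReal (K ω) ∂μ + 1 := by
        rw [add_comm]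
        gcongr

lemma HasMaskedSubgaussianMGF.lintegral_l2_opNorm_le_of_integrable
    (h : HasMaskedSubgaussianMGF A m s μ) (hs : 0 ≤ s) (hmem : ∀ i j ω, m ω i j ∈ Set.Icc 0 1)
    {v : ℝ≥0} (hv : v ≠ 0) {D₁ D₂ : Ω → ℝ} (hD₁i : Integrable D₁ μ) (hD₂i : Integrable D₂ μ)
    (hD₁ : ∀ ω, 0 ≤ D₁ ω) (hD₂ : ∀ ω, 0 ≤ D₂ ω) (hrow : ∀ i ω, ∑ j, m ω i j ≤ D₁ ω)
    (hcol : ∀ j ω, ∑ i, m ω i j ≤ D₂ ω) :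
    ∫⁻ ω, ENNReal.ofReal ‖A ω‖ ∂μ ≤ ENNReal.ofReal (s / 2 * (1 + v * μ[D₁] + v * μ[D₂] +
      v ^ 2 * ∑ i, ∑ j, ∫ ω, m ω i j ∂μ) + (v : ℝ)⁻¹) := by
  have integrable_mask (i : ι) (j : κ) : Integrable (fun ω => m ω i j) μ :=
    .of_mem_Icc 0 1 (h.measurable_mask i j).aemeasurable (.of_forall (hmem i j))
  have integrable_row (i : ι) : Integrable (fun ω => ∑ j, m ω i j) μ :=
    integrable_finsetSum _ fun j _ => integrable_mask i j
  have integrable_total : Integrable (fun ω => ∑ i, ∑ j, m ω i j) μ :=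
    integrable_finsetSum _ fun i _ => integrable_row i
  have total_nonneg (ω : Ω) : 0 ≤ ∑ i, ∑ j, m ω i j :=
    Finset.sum_nonneg fun i _ => Finset.sum_nonneg fun j _ => (hmem i j ω).1
  have integrable₁ : Integrable (fun ω => 1 + v * D₁ ω) μ :=
    (integrable_const _).add (hD₁i.const_mul _)
  have integrable₂ : Integrable (fun ω => 1 + v * D₁ ω + v * D₂ ω) μ :=
    integrable₁.add (hD₂i.const_mul _)
  have integrable₃ :
      Integrable (fun ω => 1 + v * D₁ ω + v * D₂ ω + v ^ 2 * ∑ i, ∑ j, m ω i j) μ :=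
    integrable₂.add (integrable_total.const_mul _)
  have integrable_bound : Integrable (fun ω => s / 2 *
      (1 + v * D₁ ω + v * D₂ ω + v ^ 2 * ∑ i, ∑ j, m ω i j) + (v : ℝ)⁻¹) μ :=
    (integrable₃.const_mul _).add (integrable_const _)
  refine (h.lintegral_l2_opNorm_le_lintegral (fun i j ω => (hmem i j ω).2) hs hv hD₁i.aemeasurable
    hD₂i.aemeasurable hD₁ hD₂ hrow hcol).trans_eq ?_
  rw [← ofReal_integral_eq_lintegral_ofReal integrable_bound (.of_forall fun ω => ?_)]
  · congr 1
    simp_rw [← integral_finsetSum _ fun j _ => integrable_mask _ j]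
    rw [← integral_finsetSum _ fun i _ => integrable_row i,
      integral_add (integrable₃.const_mul _) (integrable_const _), integral_const_mul,
      integral_add integrable₂ (integrable_total.const_mul _),
      integral_add integrable₁ (hD₂i.const_mul _),
      integral_add (integrable_const _) (hD₁i.const_mul _), integral_const_mul,
      integral_const_mul, integral_const_mul]
    simp only [integral_const, probReal_univ, one_smul]
  · have := hD₁ ω
    have := hD₂ ω
    have := total_nonneg ω
    simp only [Pi.zero_apply]
    positivity

lemma HasMaskedSubgaussianMGF.lintegral_l2_opNorm_le_of_sq
    (h : HasMaskedSubgaussianMGF A m s μ) (hs : 0 ≤ s)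
    (hmem : ∀ i j ω, m ω i j ∈ Set.Icc 0 1)
    (hindep : Pairwise fun e f : ι × κ => IndepFun (m · e.1 e.2) (m · f.1 f.2) μ) (hp : 0 ≤ p)
    (hmean : ∀ i j, ∫ ω, m ω i j ∂μ ≤ p) {r : ℝ} (hr : 0 < r)
    (hr2 : Fintype.card ι * Fintype.card κ * p ≤ r ^ 2) :
    ∫⁻ ω, ENNReal.ofReal ‖A ω‖ ∂μ ≤ ENNReal.ofReal
      (s / 2 * (4 + p * (Fintype.card ι + Fintype.card κ) / r) + r) := by
  have hm (i : ι) (j : κ) : AEMeasurable (fun ω => m ω i j) μ :=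
    (h.measurable_mask i j).aemeasurable
  obtain ⟨D₁, hD₁i, hD₁, hrow, hD₁mean⟩ := exists_integrable_ge_row_sums hm hmem
    (fun i j j' hj => @hindep (i, j) (i, j') (by simpa using hj)) hp hmean hr hr2
  obtain ⟨D₂, hD₂i, hD₂, hcol, hD₂mean⟩ := exists_integrable_ge_row_sums (fun j i => hm i j)
    (fun j i => hmem i j) (fun j i i' hi => @hindep (i, j) (i', j) (by simpa using hi)) hp
    (fun j i => hmean i j) hr (by rwa [mul_comm (Fintype.card κ : ℝ)])
  have total_mean_le : ∑ i, ∑ j, ∫ ω, m ω i j ∂μ ≤ r ^ 2 := by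
    calc _ ≤ ∑ _i : ι, ∑ _j : κ, p := by gcongr; exact hmean _ _
      _ = Fintype.card ι * Fintype.card κ * p := by simp [mul_assoc]
      _ ≤ r ^ 2 := hr2
  let v : ℝ≥0 := ⟨r⁻¹, (inv_pos.2 hr).le⟩
  have coe_v : (v : ℝ) = r⁻¹ := rfl
  have hv : v ≠ 0 := by rw [← NNReal.coe_ne_zero, coe_v]; positivity
  refine (h.lintegral_l2_opNorm_le_of_integrable hs hmem hv hD₁i hD₂i hD₁ hD₂ hrow hcol).trans
    (ENNReal.ofReal_le_ofReal ?_)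
  rw [coe_v, inv_inv]
  calc _ ≤ s / 2 * (1 + r⁻¹ * (Fintype.card κ * p + r) + r⁻¹ * (Fintype.card ι * p + r) +
        r⁻¹ ^ 2 * r ^ 2) + r := by gcongr
    _ = _ := by field_simp; ring

lemma sqrt_mul_le_two_mul_sqrt_add {s p P Q r : ℝ} (hs : 0 ≤ s) (hp : 0 ≤ p) (hP : 0 ≤ P)
    (hQ : 0 ≤ Q) (hr : 0 ≤ r) :
    √(s * (4 * r + p * (P + Q))) ≤ 2 * √(s * r) + √(s * p) * (√P + √Q) := by
  rw [Real.sqrt_le_left (by positivity)]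
  have h₁ := Real.sq_sqrt (mul_nonneg hs hr)
  have h₂ := Real.sq_sqrt (mul_nonneg hs hp)
  have cross : 0 ≤ √(s * p) ^ 2 * (√P * √Q) := by positivity
  have cross' : 0 ≤ √(s * r) * (√(s * p) * (√P + √Q)) := by positivity
  calc s * (4 * r + p * (P + Q))
      = 4 * √(s * r) ^ 2 + √(s * p) ^ 2 * (√P ^ 2 + √Q ^ 2) := by
        rw [h₁, h₂, Real.sq_sqrt hP, Real.sq_sqrt hQ]
        ring
    _ ≤ (2 * √(s * r) + √(s * p) * (√P + √Q)) ^ 2 := by linarith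

theorem HasMaskedSubgaussianMGF.lintegral_l2_opNorm_le [Nonempty ι] [Nonempty κ]
    (h : HasMaskedSubgaussianMGF A m s μ) (hs : 0 < s)
    (hmem : ∀ i j ω, m ω i j ∈ Set.Icc 0 1)
    (hindep : Pairwise fun e f : ι × κ => IndepFun (m · e.1 e.2) (m · f.1 f.2) μ) (hp : 0 < p)
    (hmean : ∀ i j, ∫ ω, m ω i j ∂μ ≤ p) :
    ∫⁻ ω, ENNReal.ofReal ‖A ω‖ ∂μ ≤ ENNReal.ofReal (3 *
      (√(s * p) * (√(Fintype.card ι) + √(Fintype.card κ)) +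
        √(s * √(Fintype.card ι * Fintype.card κ * p)))) := by
  set P : ℝ := (Fintype.card ι : ℝ)
  set Q : ℝ := (Fintype.card κ : ℝ)
  set r := √(P * Q * p)
  have hP : 0 < P := Nat.cast_pos.2 Fintype.card_pos
  have hQ : 0 < Q := Nat.cast_pos.2 Fintype.card_pos
  have r_pos : 0 < r := Real.sqrt_pos.2 (by positivity)
  set G := s * (4 * r + p * (P + Q)) with hG
  have G_pos : 0 < G := by positivity
  set c := r / √G with hc
  have c_pos : 0 < c := by positivity
  have scaled := (h.const_smul c).lintegral_l2_opNorm_le_of_sq (by positivity) hmem hindep hp.le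
    hmean r_pos (Real.sq_sqrt (by positivity)).ge
  calc ∫⁻ ω, ENNReal.ofReal ‖A ω‖ ∂μ
      = ENNReal.ofReal c⁻¹ * ∫⁻ ω, ENNReal.ofReal ‖c • A ω‖ ∂μ := by
        rw [← lintegral_const_mul' _ _ ENNReal.ofReal_ne_top]
        refine lintegral_congr fun ω => ?_
        rw [← ENNReal.ofReal_mul (by positivity), norm_smul, Real.norm_of_nonneg c_pos.le,
          inv_mul_cancel_left₀ c_pos.ne']
    _ ≤ ENNReal.ofReal c⁻¹ * ENNReal.ofReal (c ^ 2 * s / 2 * (4 + p * (P + Q) / r) + r) := by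
        gcongr
    _ = ENNReal.ofReal (3 / 2 * √G) := by
        rw [← ENNReal.ofReal_mul (by positivity)]
        congr 1
        calc c⁻¹ * (c ^ 2 * s / 2 * (4 + p * (P + Q) / r) + r)
            = c * G / r / 2 + r / c := by rw [hG]; field_simp
          _ = √G ^ 2 / √G / 2 + √G := by
              rw [Real.sq_sqrt G_pos.le, hc]
              field_simp
          _ = 3 / 2 * √G := by field_simp; ring
    _ ≤ ENNReal.ofReal (3 * (√(s * p) * (√P + √Q) + √(s * r))) := by
        refine ENNReal.ofReal_le_ofReal ?_
        have := sqrt_mul_le_two_mul_sqrt_add hs.le hp.le hP.le hQ.le r_pos.le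
        have : 0 ≤ √(s * p) * (√P + √Q) := by positivity
        linarith

end ExpectedOpNorm

section PruningLaw

lemma map_pi_compProd_pi {ι : Type*} [Fintype ι] {α β : ι → Type*} [∀ i, MeasurableSpace (α i)]
    [∀ i, MeasurableSpace (β i)] (μ : ∀ i, Measure (α i)) [∀ i, IsProbabilityMeasure (μ i)]
    (κ : ∀ i, Kernel (α i) (β i)) [∀ i, IsMarkovKernel (κ i)]
    (η : Kernel (∀ i, α i) (∀ i, β i)) [IsMarkovKernel η]
    (hη : ∀ x, η x = Measure.pi fun i => κ i (x i)) :
    (Measure.pi μ ⊗ₘ η).map (fun p i => (p.1 i, p.2 i)) = Measure.pi fun i => μ i ⊗ₘ κ i := by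
  have measurable_zip : Measurable fun (p : (∀ i, α i) × ∀ i, β i) i => (p.1 i, p.2 i) := by
    fun_prop
  refine (Measure.pi_eq fun s hs => ?_).symm
  have slice (x : ∀ i, α i) : η x (Prod.mk x ⁻¹' ((fun p i => (p.1 i, p.2 i)) ⁻¹' Set.univ.pi s)) =
      ∏ i, κ i (x i) (Prod.mk (x i) ⁻¹' s i) := by
    rw [hη, ← Measure.pi_pi]
    congr 1
  rw [Measure.map_apply measurable_zip (.univ_pi hs),
    Measure.compProd_apply (measurable_zip (.univ_pi hs))]
  simp_rw [slice, Measure.compProd_apply (hs _)]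
  exact lintegral_pi_prod μ fun i => Kernel.measurable_kernel_prodMk_left (hs i)

variable {L : ℕ} {n : ℕ → ℕ}

instance (Ψ : ℝ≥0) : IsProbabilityMeasure (weightLaw L n Ψ) := by
  unfold weightLaw
  infer_instance

instance (d Ψ : ℝ≥0) : IsProbabilityMeasure (jointLaw L n d Ψ) := by
  unfold jointLaw
  infer_instance

/-- The law of the coin of a single weight, given the value of this weight. -/
noncomputable def entryKernel (d Ψ : ℝ≥0) : Kernel ℝ Bool where
  toFun a := bernoulliMeasure true false (pruneProb d Ψ a)
  measurable' := measurable_bernoulli_pruneProb d Ψ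

instance (d Ψ : ℝ≥0) : IsMarkovKernel (entryKernel d Ψ) :=
  ⟨fun a => inferInstanceAs (IsProbabilityMeasure (bernoulliMeasure true false (pruneProb d Ψ a)))⟩

/-- The joint law of a single weight and its coin. -/
noncomputable def entryLaw (d Ψ : ℝ≥0) : Measure (ℝ × Bool) :=
  gaussianReal 0 Ψ ⊗ₘ entryKernel d Ψ

instance (d Ψ : ℝ≥0) : IsProbabilityMeasure (entryLaw d Ψ) := by
  unfold entryLaw
  infer_instance

lemma map_jointLaw_eq_pi_entryLaw (d Ψ : ℝ≥0) :
    (jointLaw L n d Ψ).map (fun p e => (p.1 e, p.2 e)) = Measure.pi fun _ => entryLaw d Ψ :=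
  map_pi_compProd_pi _ (fun _ => entryKernel d Ψ) (coinKernel L n d Ψ) fun _ => rfl

lemma measurePreserving_entry (d Ψ : ℝ≥0) (e : Entry L n) :
    MeasurePreserving (fun p => (p.1 e, p.2 e)) (jointLaw L n d Ψ) (entryLaw d Ψ) :=
  (measurePreserving_eval (fun _ : Entry L n => entryLaw d Ψ) e).comp
    ⟨by fun_prop, map_jointLaw_eq_pi_entryLaw d Ψ⟩

lemma iIndepFun_entry (d Ψ : ℝ≥0) :
    iIndepFun (fun (e : Entry L n) p => (p.1 e, p.2 e)) (jointLaw L n d Ψ) := by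
  rw [iIndepFun_iff_map_fun_eq_pi_map fun e => (measurePreserving_entry d Ψ e).aemeasurable]
  simp_rw [(measurePreserving_entry d Ψ _).map_eq]
  exact map_jointLaw_eq_pi_entryLaw d Ψ

lemma lintegral_bernoulliMeasure_bool (p : I) (f : Bool → ℝ≥0∞) :
    ∫⁻ b, f b ∂bernoulliMeasure true false p =
      ENNReal.ofReal p * f true + ENNReal.ofReal (1 - p) * f false := by
  have coe_eq (q : I) : ((unitInterval.toNNReal q : ℝ≥0) : ℝ≥0∞) = ENNReal.ofReal q := by
    rw [← unitInterval.coe_toNNReal q, ENNReal.ofReal_coe_nnreal]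
  rw [bernoulliMeasure_def, lintegral_add_measure, lintegral_smul_measure,
    lintegral_smul_measure, lintegral_dirac, lintegral_dirac, ← unitInterval.coe_symm_eq p,
    ← coe_eq, ← coe_eq]
  rfl

lemma lintegral_entryLaw (d Ψ : ℝ≥0) {f : ℝ × Bool → ℝ≥0∞} (hf : Measurable f) :
    ∫⁻ q, f q ∂entryLaw d Ψ = ∫⁻ a, (ENNReal.ofReal (pruneProb d Ψ a) * f (a, true) +
      ENNReal.ofReal (1 - pruneProb d Ψ a) * f (a, false)) ∂gaussianReal 0 Ψ :=
  (Measure.lintegral_compProd hf).trans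
    (lintegral_congr fun a => lintegral_bernoulliMeasure_bool _ fun b => f (a, b))

/-- The probability with which an off-diagonal weight is pruned. -/
noncomputable def rate (d : ℝ≥0) : ℝ := √(d / (d + 2))

/-- The variance of a weight conditionally on its coin being `true`. -/
noncomputable def prunedVar (d Ψ : ℝ≥0) : ℝ≥0 := d * Ψ / (d + 2)

variable {d Ψ : ℝ≥0}

lemma rate_pos (hd : 0 < d) : 0 < rate d := by
  unfold rate
  positivity

lemma prunedVar_pos (hd : 0 < d) (hΨ : 0 < Ψ) : 0 < prunedVar d Ψ := by
  unfold prunedVar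
  positivity

lemma gaussianPDFReal_mul_pruneProb (hd : 0 < d) (hΨ : 0 < Ψ) (a : ℝ) :
    gaussianPDFReal 0 Ψ a * pruneProb d Ψ a =
      rate d * gaussianPDFReal 0 (prunedVar d Ψ) a := by
  simp only [gaussianPDFReal, pruneProb, rate, prunedVar]
  push_cast
  have normalization : (√(2 * Real.pi * Ψ))⁻¹ =
      √(d / (d + 2)) * (√(2 * Real.pi * (d * Ψ / (d + 2))))⁻¹ := by
    rw [← Real.sqrt_inv, ← Real.sqrt_inv, ← Real.sqrt_mul (by positivity)]
    congr 1
    field_simp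
  rw [mul_assoc, ← Real.exp_add, ← mul_assoc, ← normalization]
  congr 2
  field_simp
  ring

lemma measurable_coe_pruneProb (d Ψ : ℝ≥0) : Measurable fun a => (pruneProb d Ψ a : ℝ) :=
  measurable_subtype_coe.comp (measurable_pruneProb d Ψ)

lemma lintegral_pruneProb_mul (hd : 0 < d) (hΨ : 0 < Ψ) {f : ℝ → ℝ≥0∞} (hf : Measurable f) :
    ∫⁻ a, ENNReal.ofReal (pruneProb d Ψ a) * f a ∂gaussianReal 0 Ψ =
      ENNReal.ofReal (rate d) * ∫⁻ a, f a ∂gaussianReal 0 (prunedVar d Ψ) := by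
  rw [gaussianReal_of_var_ne_zero _ hΨ.ne',
    gaussianReal_of_var_ne_zero _ (prunedVar_pos hd hΨ).ne',
    lintegral_withDensity_eq_lintegral_mul _ (measurable_gaussianPDF _ _)
      ((measurable_coe_pruneProb d Ψ).ennreal_ofReal.fun_mul hf),
    lintegral_withDensity_eq_lintegral_mul _ (measurable_gaussianPDF _ _) hf,
    ← lintegral_const_mul _ ((measurable_gaussianPDF _ _).mul hf)]
  refine lintegral_congr fun a => ?_
  simp only [Pi.mul_apply, gaussianPDF]
  rw [← mul_assoc, ← mul_assoc, ← ENNReal.ofReal_mul (gaussianPDFReal_nonneg _ _ _),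
    gaussianPDFReal_mul_pruneProb hd hΨ, ENNReal.ofReal_mul (rate_pos hd).le]

lemma lintegral_pruneProb (hd : 0 < d) (hΨ : 0 < Ψ) :
    ∫⁻ a, ENNReal.ofReal (pruneProb d Ψ a) ∂gaussianReal 0 Ψ = ENNReal.ofReal (rate d) := by
  simpa using lintegral_pruneProb_mul hd hΨ (f := fun _ => 1) measurable_const

lemma lintegral_exp_gaussianReal_eq_one (v : ℝ≥0) (τ : ℝ) :
    ∫⁻ a, ENNReal.ofReal (Real.exp (a * τ - v / 2 * τ ^ 2)) ∂gaussianReal 0 v = 1 := by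
  have mgf_eq : ∫ a, Real.exp (τ * a) ∂gaussianReal 0 v = Real.exp (v / 2 * τ ^ 2) := by
    have h := congrFun (mgf_id_gaussianReal (μ := 0) (v := v)) τ
    simp only [mgf, id, zero_mul, zero_add] at h
    rw [h]
    ring_nf
  have integrable_exp : Integrable (fun a => Real.exp (a * τ - v / 2 * τ ^ 2))
      (gaussianReal 0 v) := by
    simp_rw [Real.exp_sub, mul_comm _ τ]
    exact (integrable_exp_mul_gaussianReal τ).div_const _
  rw [← ofReal_integral_eq_lintegral_ofReal integrable_exp
    (.of_forall fun a => (Real.exp_pos _).le)]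
  simp_rw [Real.exp_sub, mul_comm _ τ]
  rw [integral_div, mgf_eq, div_self (Real.exp_pos _).ne', ENNReal.ofReal_one]

/-- The indicator that the weight at position `e` is pruned when its coin shows `b`. -/
def pruneIndicator (e : Entry L n) (b : Bool) : ℝ :=
  if (e.2.1 : ℕ) ≠ (e.2.2 : ℕ) ∧ b = true then 1 else 0

lemma pruneIndicator_mem_Icc (e : Entry L n) (b : Bool) : pruneIndicator e b ∈ Set.Icc 0 1 := by
  unfold pruneIndicator
  split_ifs <;> simp

lemma measurable_pruneIndicator (e : Entry L n) : Measurable (pruneIndicator e) :=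
  measurable_of_countable _

lemma lintegral_exp_pruneIndicator_eq_one (hd : 0 < d) (hΨ : 0 < Ψ) (e : Entry L n) (τ : ℝ) :
    ∫⁻ q, ENNReal.ofReal (Real.exp (pruneIndicator e q.2 * q.1 * τ -
      prunedVar d Ψ / 2 * pruneIndicator e q.2 * τ ^ 2)) ∂entryLaw d Ψ = 1 := by
  by_cases he : (e.2.1 : ℕ) ≠ e.2.2
  · have := measurable_coe_pruneProb d Ψ
    have hm := measurable_pruneIndicator e
    rw [lintegral_entryLaw d Ψ (by fun_prop)]
    simp only [pruneIndicator, he, ne_eq, not_false_eq_true, and_self, Bool.false_eq_true,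
      and_false, if_true, if_false, one_mul, zero_mul, mul_one, mul_zero, sub_zero, Real.exp_zero,
      ENNReal.ofReal_one]
    have prob_add_compl (a : ℝ) : ENNReal.ofReal (pruneProb d Ψ a) +
        ENNReal.ofReal (1 - pruneProb d Ψ a) = 1 := by
      rw [← ENNReal.ofReal_add (pruneProb d Ψ a).2.1 (sub_nonneg.2 (pruneProb d Ψ a).2.2),
        add_sub_cancel, ENNReal.ofReal_one]
    rw [lintegral_add_right _ (by fun_prop), lintegral_pruneProb_mul hd hΨ (by fun_prop),
      lintegral_exp_gaussianReal_eq_one, mul_one, ← lintegral_pruneProb hd hΨ,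
      ← lintegral_add_right _ (by fun_prop)]
    simp_rw [prob_add_compl]
    simp
  · simp [pruneIndicator, he]

lemma integral_pruneIndicator_le_rate (hd : 0 < d) (hΨ : 0 < Ψ) (e : Entry L n) :
    ∫ q, pruneIndicator e q.2 ∂entryLaw d Ψ ≤ rate d := by
  have := measurable_coe_pruneProb d Ψ
  have hm := measurable_pruneIndicator e
  have nonneg : 0 ≤ᵐ[entryLaw d Ψ] fun q => pruneIndicator e q.2 :=
    .of_forall fun q => (pruneIndicator_mem_Icc e q.2).1
  rw [integral_eq_lintegral_of_nonneg_ae nonneg (by fun_prop), lintegral_entryLaw d Ψ (by fun_prop)]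
  refine ENNReal.toReal_le_of_le_ofReal (rate_pos hd).le ?_
  rw [← lintegral_pruneProb hd hΨ]
  refine lintegral_mono fun a => ?_
  simp only [pruneIndicator, Bool.false_eq_true, and_false, if_false, ENNReal.ofReal_zero,
    mul_zero, add_zero]
  refine mul_le_of_le_one_right zero_le ?_
  split_ifs <;> simp

end PruningLaw

section LayerError

variable {L : ℕ} {n : ℕ → ℕ} {d Ψ : ℝ≥0}

/-- The part of the weight matrix of layer `l` that is removed by the pruning. -/
noncomputable def pruneError (w : Weights L n) (X : Coins L n) (l : Fin L) :
    Matrix (Fin (n (l + 1))) (Fin (n l)) ℝ :=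
  layer w l - layer (prune w X) l

/-- The matrix of the indicators of the pruned weights of layer `l`. -/
def pruneMask (X : Coins L n) (l : Fin L) : Matrix (Fin (n (l + 1))) (Fin (n l)) ℝ :=
  Matrix.of fun i j => pruneIndicator ⟨l, i, j⟩ (X ⟨l, i, j⟩)

lemma pruneError_apply (w : Weights L n) (X : Coins L n) (l : Fin L) (i : Fin (n (l + 1)))
    (j : Fin (n l)) : pruneError w X l i j = pruneMask X l i j * w ⟨l, i, j⟩ := by
  simp only [pruneError, pruneMask, layer, prune, pruneIndicator, Matrix.sub_apply,
    Matrix.of_apply]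
  split_ifs <;> simp

lemma iIndepFun_layer_entry (d Ψ : ℝ≥0) (l : Fin L) :
    iIndepFun (fun (e : Fin (n (l + 1)) × Fin (n l)) (p : Weights L n × Coins L n) =>
      (p.1 ⟨l, e⟩, p.2 ⟨l, e⟩)) (jointLaw L n d Ψ) :=
  (iIndepFun_entry d Ψ).precomp sigma_mk_injective

lemma hasMaskedSubgaussianMGF_pruneError (hd : 0 < d) (hΨ : 0 < Ψ) (l : Fin L) :
    HasMaskedSubgaussianMGF (fun p => pruneError p.1 p.2 l) (fun p => pruneMask p.2 l)
      (prunedVar d Ψ) (jointLaw L n d Ψ) where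
  measurable_entry i j := by
    have := measurable_pruneIndicator (⟨l, i, j⟩ : Entry L n)
    simp only [pruneError_apply, pruneMask, Matrix.of_apply]
    fun_prop
  measurable_mask i j := by
    have := measurable_pruneIndicator (⟨l, i, j⟩ : Entry L n)
    simp only [pruneMask, Matrix.of_apply]
    fun_prop
  lintegral_exp_le_one x y := by
    let f (e : Fin (n (l + 1)) × Fin (n l)) (q : ℝ × Bool) : ℝ≥0∞ :=
      ENNReal.ofReal (Real.exp (pruneIndicator (⟨l, e⟩ : Entry L n) q.2 * q.1 * (x e.1 * y e.2) -
        prunedVar d Ψ / 2 * pruneIndicator (⟨l, e⟩ : Entry L n) q.2 * (x e.1 * y e.2) ^ 2))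
    have measurable_f (e : Fin (n (l + 1)) × Fin (n l)) : Measurable (f e) := by
      have := measurable_pruneIndicator (⟨l, e⟩ : Entry L n)
      fun_prop
    calc _ = ∫⁻ p, ∏ e, f e (p.1 ⟨l, e⟩, p.2 ⟨l, e⟩) ∂jointLaw L n d Ψ := by
          refine lintegral_congr fun p => ?_
          rw [← ENNReal.ofReal_prod_of_nonneg fun _ _ => (Real.exp_pos _).le, ← Real.exp_sum,
            Fintype.sum_prod_type]
          simp only [pruneError_apply, pruneMask, Matrix.of_apply, mul_pow]
      _ = ∏ e, ∫⁻ p, f e (p.1 ⟨l, e⟩, p.2 ⟨l, e⟩) ∂jointLaw L n d Ψ :=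
          lintegral_prod_eq_prod_lintegral_of_indepFun Finset.univ _
            ((iIndepFun_layer_entry d Ψ l).comp f measurable_f)
            fun e => (measurable_f e).comp (by fun_prop)
      _ = 1 := Finset.prod_eq_one fun e _ =>
          ((measurePreserving_entry d Ψ ⟨l, e⟩).lintegral_comp (measurable_f e)).trans
            (lintegral_exp_pruneIndicator_eq_one hd hΨ _ _)
      _ ≤ 1 := le_rfl

lemma indepFun_pruneMask (d Ψ : ℝ≥0) (l : Fin L) {e f : Fin (n (l + 1)) × Fin (n l)}
    (hef : e ≠ f) :
    IndepFun (fun p => pruneMask p.2 l e.1 e.2) (fun p => pruneMask p.2 l f.1 f.2)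
      (jointLaw L n d Ψ) :=
  ((iIndepFun_layer_entry d Ψ l).indepFun hef).comp
    ((measurable_pruneIndicator ⟨l, e⟩).comp measurable_snd)
    ((measurable_pruneIndicator ⟨l, f⟩).comp measurable_snd)

lemma integral_pruneMask_le_rate (hd : 0 < d) (hΨ : 0 < Ψ) (l : Fin L) (i : Fin (n (l + 1)))
    (j : Fin (n l)) : ∫ p, pruneMask p.2 l i j ∂jointLaw L n d Ψ ≤ rate d := by
  have measurable_indicator : Measurable fun q : ℝ × Bool =>
      pruneIndicator (⟨l, i, j⟩ : Entry L n) q.2 :=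
    (measurable_pruneIndicator _).comp measurable_snd
  refine le_of_eq_of_le ?_ (integral_pruneIndicator_le_rate (Ψ := Ψ) hd hΨ (⟨l, i, j⟩ : Entry L n))
  rw [← (measurePreserving_entry d Ψ ⟨l, i, j⟩).map_eq,
    integral_map (by fun_prop) measurable_indicator.aestronglyMeasurable]
  rfl

lemma rpow_mul_div_rpow_eq_prunedVar_mul_rate (hd : 0 < d) :
    (d : ℝ) ^ (3 / 2 : ℝ) * Ψ / ((d : ℝ) + 2) ^ (3 / 2 : ℝ) = prunedVar d Ψ * rate d := by
  have rpow_eq {x : ℝ} (hx : 0 < x) : x ^ (3 / 2 : ℝ) = x * √x := by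
    rw [show (3 / 2 : ℝ) = 1 + 1 / 2 by norm_num, Real.rpow_add hx, Real.rpow_one,
      Real.sqrt_eq_rpow]
  rw [rpow_eq (by positivity), rpow_eq (by positivity), rate, prunedVar,
    Real.sqrt_div d.coe_nonneg]
  push_cast
  field_simp

lemma rpow_mul_sq_div_rpow_eq_prunedVar_sq_mul_rate (hd : 0 < d) :
    (d : ℝ) ^ (5 / 2 : ℝ) * (Ψ : ℝ) ^ 2 / ((d : ℝ) + 2) ^ (5 / 2 : ℝ) =
      prunedVar d Ψ ^ 2 * rate d := by
  have rpow_eq {x : ℝ} (hx : 0 < x) : x ^ (5 / 2 : ℝ) = x ^ 2 * √x := by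
    rw [show (5 / 2 : ℝ) = (2 : ℕ) + 1 / 2 by norm_num, Real.rpow_add hx, Real.rpow_natCast,
      Real.sqrt_eq_rpow]
  rw [rpow_eq (by positivity), rpow_eq (by positivity), rate, prunedVar,
    Real.sqrt_div d.coe_nonneg]
  push_cast
  field_simp

lemma Gam_eq (C : ℝ) (hd : 0 < d) (d₁ d₂ : ℕ) :
    Gam C d Ψ d₁ d₂ = C * (√(prunedVar d Ψ * rate d) * (√d₁ + √d₂) +
      √(prunedVar d Ψ * √(d₁ * d₂ * (3 * rate d)))) := by
  have sqrt_eq_rpow : √(prunedVar d Ψ * √(d₁ * d₂ * (3 * rate d))) =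
      (3 * d₁ * d₂ * (prunedVar d Ψ ^ 2 * rate d)) ^ (1 / 4 : ℝ) := by
    rw [show (1 / 4 : ℝ) = 1 / 2 * (1 / 2) by norm_num,
      Real.rpow_mul (by unfold rate; positivity), ← Real.sqrt_eq_rpow, ← Real.sqrt_eq_rpow,
      show 3 * d₁ * d₂ * (prunedVar d Ψ ^ 2 * rate d) =
        (prunedVar d Ψ : ℝ) ^ 2 * (d₁ * d₂ * (3 * rate d)) by ring,
      Real.sqrt_mul (sq_nonneg (prunedVar d Ψ : ℝ)), Real.sqrt_sq (prunedVar d Ψ).coe_nonneg]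
  rw [Gam, rpow_mul_div_rpow_eq_prunedVar_mul_rate hd, mul_assoc (3 * d₁ * d₂ : ℝ), mul_div_assoc,
    rpow_mul_sq_div_rpow_eq_prunedVar_sq_mul_rate hd, sqrt_eq_rpow]

lemma Gam_nonneg {C : ℝ} (hC : 0 ≤ C) (d Ψ : ℝ≥0) (d₁ d₂ : ℕ) : 0 ≤ Gam C d Ψ d₁ d₂ := by
  unfold Gam
  positivity

theorem lintegral_norm_pruneError_le (hd : 0 < d) (hΨ : 0 < Ψ) (l : Fin L) :
    ∫⁻ p, ENNReal.ofReal ‖pruneError p.1 p.2 l‖ ∂jointLaw L n d Ψ ≤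
      ENNReal.ofReal (Gam 3 d Ψ (n (l + 1)) (n l)) := by
  have hr := rate_pos hd
  rcases isEmpty_or_nonempty (Fin (n (l + 1))) with _ | _
  · simp [Subsingleton.elim (pruneError _ _ l) 0]
  rcases isEmpty_or_nonempty (Fin (n l)) with _ | _
  · simp [Subsingleton.elim (pruneError _ _ l) 0]
  refine ((hasMaskedSubgaussianMGF_pruneError hd hΨ l).lintegral_l2_opNorm_le
    (prunedVar_pos hd hΨ) (fun i j p => pruneIndicator_mem_Icc _ _)
    (fun e f hef => indepFun_pruneMask d Ψ l hef) hr
    (integral_pruneMask_le_rate hd hΨ l)).trans (ENNReal.ofReal_le_ofReal ?_)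
  rw [Gam_eq _ hd, Fintype.card_fin, Fintype.card_fin]
  gcongr
  linarith

end LayerError

section Perturbation

lemma norm_toEuclideanLin_apply_le {ι κ : Type*} [Fintype ι] [Fintype κ] [DecidableEq κ]
    (A : Matrix ι κ ℝ) (v : EuclideanSpace ℝ κ) : ‖A.toEuclideanLin v‖ ≤ ‖A‖ * ‖v‖ :=
  A.l2_opNorm_mulVec v

variable {L : ℕ} {n : ℕ → ℕ}

lemma specNorm_eq_norm {p q : ℕ} (A : Matrix (Fin p) (Fin q) ℝ) : specNorm A = ‖A‖ :=
  (Matrix.l2_opNorm_def A).symm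

/-- The vectors `x`, `ψ₀ (A₀ x)`, `ψ₁ (A₁ ψ₀ (A₀ x))`, … which are the inputs of the successive
layers of the network with weights `w` and activations `ψ`. -/
noncomputable def act (w : Weights L n) (ψ : ∀ l : Fin L, Vec (n (l + 1)) → Vec (n (l + 1)))
    (x : Vec (n 0)) : ∀ l : ℕ, l ≤ L → Vec (n l)
  | 0, _ => x
  | l + 1, h => ψ ⟨l, h⟩ ((layer w ⟨l, h⟩).toEuclideanLin (act w ψ x l (Nat.le_of_succ_le h)))

/-- The activations `φ`, with the identity in the output layer. With them `output` becomes a value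
of `act`, so that all the layers can be treated alike. -/
def withOutputId (φ : ∀ l : Fin L, Vec (n (l + 1)) → Vec (n (l + 1))) :
    ∀ l : Fin L, Vec (n (l + 1)) → Vec (n (l + 1)) :=
  fun l => if (l : ℕ) + 1 < L then φ l else id

lemma forward_succ (w : Weights L n) (φ : ∀ l : Fin L, Vec (n (l + 1)) → Vec (n (l + 1)))
    (x : Vec (n 0)) : ∀ (l : ℕ) (h : l + 1 ≤ L), forward w φ x (l + 1) h =
      (layer w ⟨l, h⟩).toEuclideanLin (act w (withOutputId φ) x l (Nat.le_of_succ_le h))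
  | 0, _ => rfl
  | l + 1, h => by
    rw [forward, forward_succ w φ x l, act, withOutputId, if_pos (by simpa using h)]

lemma output_eq_act (w : Weights L n) (φ : ∀ l : Fin L, Vec (n (l + 1)) → Vec (n (l + 1)))
    (x : Vec (n 0)) : output w φ x = act w (withOutputId φ) x L le_rfl := by
  cases L with
  | zero => rfl
  | succ L => rw [output, forward_succ, act, withOutputId, if_neg (by simp), id]

variable {φ ψ : ∀ l : Fin L, Vec (n (l + 1)) → Vec (n (l + 1))} {Lip : Fin L → ℝ≥0}

lemma lipschitzWith_withOutputId (hφ : ∀ l : Fin L, (l : ℕ) + 1 < L → LipschitzWith (Lip l) (φ l))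
    (hLip : ∀ l : Fin L, (l : ℕ) + 1 = L → 1 ≤ Lip l) (l : Fin L) :
    LipschitzWith (Lip l) (withOutputId φ l) := by
  unfold withOutputId
  split_ifs with h
  · exact hφ l h
  · exact LipschitzWith.id.weaken (hLip l (by omega))

lemma withOutputId_zero (hφ : ∀ l : Fin L, (l : ℕ) + 1 < L → φ l 0 = 0) (l : Fin L) :
    withOutputId φ l 0 = 0 := by
  unfold withOutputId
  split_ifs with h
  · exact hφ l h
  · rfl

/-- The bound `∏_{k < l} Lₖ ‖Aₖ‖` for the Lipschitz constant of the first `l` layers. -/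
noncomputable def gain (Lip : Fin L → ℝ≥0) (w : Weights L n) (l : ℕ) (hl : l ≤ L) : ℝ :=
  ∏ k : Fin l, (Lip (k.castLE hl) : ℝ) * ‖layer w (k.castLE hl)‖

lemma gain_zero (Lip : Fin L → ℝ≥0) (w : Weights L n) : gain Lip w 0 L.zero_le = 1 := by
  simp [gain]

lemma gain_succ (Lip : Fin L → ℝ≥0) (w : Weights L n) (k : Fin L) :
    gain Lip w (k + 1) k.2 = Lip k * (‖layer w k‖ * gain Lip w k k.2.le) := by
  rw [gain, Fin.prod_univ_castSucc, mul_comm, mul_assoc]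
  rfl

lemma gain_nonneg (Lip : Fin L → ℝ≥0) (w : Weights L n) (l : ℕ) (hl : l ≤ L) :
    0 ≤ gain Lip w l hl :=
  Finset.prod_nonneg fun _ _ => by positivity

lemma act_congr {w w' : Weights L n} (x : Vec (n 0)) : ∀ (l : ℕ) (hl : l ≤ L),
    (∀ k : Fin L, (k : ℕ) < l → layer w k = layer w' k) → act w ψ x l hl = act w' ψ x l hl
  | 0, _, _ => rfl
  | l + 1, hl, h => by
    rw [act, act, act_congr x l _ fun k hk => h k (hk.trans l.lt_succ_self),
      h ⟨l, hl⟩ l.lt_succ_self]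

lemma gain_congr {w w' : Weights L n} {l : ℕ} {hl : l ≤ L}
    (h : ∀ k : Fin L, (k : ℕ) < l → ‖layer w k‖ = ‖layer w' k‖) :
    gain Lip w l hl = gain Lip w' l hl :=
  Finset.prod_congr rfl fun k _ => by rw [h _ k.2]

lemma norm_act_le (hψ : ∀ l, LipschitzWith (Lip l) (ψ l)) (hψ0 : ∀ l, ψ l 0 = 0)
    {w w' : Weights L n} (x : Vec (n 0)) {c : ℝ} (hc : 0 ≤ c)
    (h : ∀ l, ‖layer w' l‖ ≤ c * ‖layer w l‖) : ∀ (l : ℕ) (hl : l ≤ L),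
      ‖act w' ψ x l hl‖ ≤ c ^ l * gain Lip w l hl * ‖x‖
  | 0, _ => by simp [act, gain_zero]
  | l + 1, hl => by
    set k : Fin L := ⟨l, hl⟩
    have ih := norm_act_le hψ hψ0 x hc h l (Nat.le_of_succ_le hl)
    calc ‖act w' ψ x (l + 1) hl‖
        ≤ Lip k * ‖(layer w' k).toEuclideanLin (act w' ψ x l _)‖ :=
          (hψ k).norm_le_mul (hψ0 k) _
      _ ≤ Lip k * (‖layer w' k‖ * ‖act w' ψ x l _‖) := by
          gcongr
          exact norm_toEuclideanLin_apply_le _ _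
      _ ≤ Lip k * (c * ‖layer w k‖ * (c ^ l * gain Lip w l _ * ‖x‖)) := by
          gcongr
          exact h k
      _ = c ^ (l + 1) * gain Lip w (l + 1) hl * ‖x‖ := by
          rw [gain_succ Lip w k]
          ring

lemma act_eq_zero_of_gain_eq_zero (hψ : ∀ l, LipschitzWith (Lip l) (ψ l)) (hψ0 : ∀ l, ψ l 0 = 0)
    {w w' : Weights L n} (hw : ∀ l, layer w l = 0 → layer w' l = 0) (x : Vec (n 0)) :
    ∀ (l : ℕ) (hl : l ≤ L), gain Lip w l hl = 0 → act w' ψ x l hl = 0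
  | 0, _, h => by simp [gain_zero] at h
  | l + 1, hl, h => by
    set k : Fin L := ⟨l, hl⟩
    have norm_le := (hψ k).norm_le_mul (hψ0 k)
      ((layer w' k).toEuclideanLin (act w' ψ x l (Nat.le_of_succ_le hl)))
    rw [gain_succ Lip w k, mul_eq_zero, mul_eq_zero, norm_eq_zero] at h
    rw [act, ← norm_le_zero_iff]
    refine norm_le.trans_eq ?_
    rcases h with Lip_eq_zero | layer_eq_zero | gain_eq_zero
    · rw [Lip_eq_zero, zero_mul]
    · simp [hw k layer_eq_zero]
    · simp [act_eq_zero_of_gain_eq_zero hψ hψ0 hw x l _ gain_eq_zero]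

lemma norm_act_sub_act_le (hψ : ∀ l, LipschitzWith (Lip l) (ψ l)) {w w' : Weights L n}
    (hw : ∀ l, layer w l = 0 → layer w' l = 0) {x : Vec (n 0)} {g : Fin L → ℝ}
    (h : ∀ l : Fin L, ‖(layer w l - layer w' l).toEuclideanLin (act w' ψ x l l.2.le)‖ ≤
      g l * gain Lip w l l.2.le) : ∀ (l : ℕ) (hl : l ≤ L),
      ‖act w' ψ x l hl - act w ψ x l hl‖ ≤
        gain Lip w l hl * ∑ k : Fin l, g (k.castLE hl) / ‖layer w (k.castLE hl)‖
  | 0, _ => by simp [act]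
  | l + 1, hl => by
    set k : Fin L := ⟨l, hl⟩
    set u' := act w' ψ x l (Nat.le_of_succ_le hl)
    set u := act w ψ x l (Nat.le_of_succ_le hl)
    set S := ∑ j : Fin l, g (j.castLE (Nat.le_of_succ_le hl)) /
      ‖layer w (j.castLE (Nat.le_of_succ_le hl))‖
    have ih : ‖u' - u‖ ≤ gain Lip w l _ * S := norm_act_sub_act_le hψ hw h l _
    have sum_succ : ∑ j : Fin (l + 1), g (j.castLE hl) / ‖layer w (j.castLE hl)‖ =
        S + g k / ‖layer w k‖ := Fin.sum_univ_castSucc _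
    rw [sum_succ, gain_succ Lip w k]
    change ‖ψ k ((layer w' k).toEuclideanLin u') - ψ k ((layer w k).toEuclideanLin u)‖ ≤ _
    rcases eq_or_ne (layer w k) 0 with layer_eq_zero | layer_ne_zero
    · simp [layer_eq_zero, hw k layer_eq_zero]
    calc _ ≤ Lip k * ‖(layer w' k).toEuclideanLin u' - (layer w k).toEuclideanLin u‖ :=
          (hψ k).norm_sub_le _ _
      _ = Lip k * ‖(layer w k).toEuclideanLin (u' - u) -
            (layer w k - layer w' k).toEuclideanLin u'‖ := by
          rw [map_sub, map_sub, LinearMap.sub_apply]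
          congr 2
          abel
      _ ≤ Lip k * (‖layer w k‖ * (gain Lip w l _ * S) + g k * gain Lip w l _) := by
          gcongr
          refine (norm_sub_le _ _).trans (add_le_add ?_ (h k))
          exact (norm_toEuclideanLin_apply_le _ _).trans (by gcongr)
      _ = _ := by
          have := norm_ne_zero_iff.2 layer_ne_zero
          field_simp
          ring

lemma layer_prune_eq_zero {w : Weights L n} (X : Coins L n) {l : Fin L} (h : layer w l = 0) :
    layer (prune w X) l = 0 := by
  ext i j
  have : w ⟨l, i, j⟩ = 0 := congrFun₂ h i j
  simp [layer, prune, this]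

lemma norm_output_sub_output_le_errorBound (hψ : ∀ l, LipschitzWith (Lip l) (withOutputId φ l))
    {C : ℝ} {d Ψ : ℝ≥0} {ε : Fin L → ℝ} {w : Weights L n} {X : Coins L n} {x : Vec (n 0)}
    (h : ∀ l : Fin L, ‖(pruneError w X l).toEuclideanLin
      (act (prune w X) (withOutputId φ) x l l.2.le)‖ ≤
        Real.exp 1 * n 0 * (ε l * Gam C d Ψ (n (l + 1)) (n l)) * gain Lip w l l.2.le) :
    ‖output (prune w X) φ x - output w φ x‖ ≤ errorBound C d Ψ ε Lip w := by
  rw [output_eq_act, output_eq_act]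
  refine (norm_act_sub_act_le hψ (fun l => layer_prune_eq_zero X) h L le_rfl).trans_eq ?_
  simp only [errorBound, specNorm_eq_norm, gain, Fin.castLE_rfl, id, mul_div_assoc, Finset.mul_sum]
  exact Finset.sum_congr rfl fun l _ => by ring

lemma one_add_inv_pow_le_exp {l : ℕ} (hl : l ≤ L) : (1 + 1 / (L : ℝ)) ^ l ≤ Real.exp 1 := by
  calc (1 + 1 / (L : ℝ)) ^ l ≤ Real.exp (1 / L) ^ l := by
        gcongr
        linarith [Real.add_one_le_exp (1 / (L : ℝ))]
    _ = Real.exp (l / L) := by rw [← Real.exp_nat_mul, mul_one_div]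
    _ ≤ Real.exp 1 := Real.exp_le_exp.2 (div_le_one_of_le₀ (mod_cast hl) L.cast_nonneg)

end Perturbation

section Measurability

variable {L : ℕ} {n : ℕ → ℕ} {ψ : ∀ l : Fin L, Vec (n (l + 1)) → Vec (n (l + 1))}

lemma continuous_layer (l : Fin L) : Continuous fun w : Weights L n => layer w l := by
  unfold layer
  fun_prop

lemma continuous_prune (X : Coins L n) : Continuous fun w : Weights L n => prune w X := by
  refine continuous_pi fun e => ?_
  unfold prune
  split_ifs <;> fun_prop

lemma continuous_pruneError (X : Coins L n) (l : Fin L) :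
    Continuous fun w : Weights L n => pruneError w X l :=
  (continuous_layer l).sub ((continuous_layer l).comp (continuous_prune X))

lemma continuous_toEuclideanLin_apply {Ω ι κ : Type*} [TopologicalSpace Ω] [Fintype κ]
    [DecidableEq κ] {A : Ω → Matrix ι κ ℝ} {v : Ω → EuclideanSpace ℝ κ} (hA : Continuous A)
    (hv : Continuous v) : Continuous fun ω => (A ω).toEuclideanLin (v ω) := by
  simp only [Matrix.toLpLin_apply]
  fun_prop

lemma continuous_act (hψ : ∀ l, Continuous (ψ l)) (x : Vec (n 0)) :
    ∀ (l : ℕ) (hl : l ≤ L), Continuous fun w : Weights L n => act w ψ x l hl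
  | 0, _ => continuous_const
  | l + 1, _ => (hψ _).comp (continuous_toEuclideanLin_apply (continuous_layer _)
      (continuous_act hψ x l _))

lemma continuous_gain (Lip : Fin L → ℝ≥0) (l : ℕ) (hl : l ≤ L) :
    Continuous fun w : Weights L n => gain Lip w l hl :=
  continuous_finsetProd _ fun _ _ => continuous_const.mul (continuous_layer _).norm

lemma measurable_of_continuous_weights {f : Weights L n × Coins L n → ℝ}
    (hf : ∀ X, Continuous fun w => f (w, X)) : Measurable f :=
  measurable_from_prod_countable_left fun X => (hf X).measurable

lemma measurable_norm_pruneError (l : Fin L) :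
    Measurable fun p : Weights L n × Coins L n => ‖pruneError p.1 p.2 l‖ :=
  measurable_of_continuous_weights fun X => (continuous_pruneError X l).norm

lemma measurable_norm_act_div_gain (hψ : ∀ l, Continuous (ψ l)) (Lip : Fin L → ℝ≥0)
    (x : Vec (n 0)) (l : ℕ) (hl : l ≤ L) :
    Measurable fun p : Weights L n × Coins L n =>
      ‖act (prune p.1 p.2) ψ x l hl‖ / gain Lip p.1 l hl :=
  (measurable_of_continuous_weights fun X =>
    ((continuous_act hψ x l hl).comp (continuous_prune X)).norm).div
      ((continuous_gain Lip l hl).measurable.comp measurable_fst)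

lemma measurable_norm_pruneError_act_div_gain (hψ : ∀ l, Continuous (ψ l)) (Lip : Fin L → ℝ≥0)
    (x : Vec (n 0)) (l : Fin L) :
    Measurable fun p : Weights L n × Coins L n =>
      ‖(pruneError p.1 p.2 l).toEuclideanLin (act (prune p.1 p.2) ψ x l l.2.le)‖ /
        gain Lip p.1 l l.2.le :=
  (measurable_of_continuous_weights fun X => (continuous_toEuclideanLin_apply
    (continuous_pruneError X l) ((continuous_act hψ x l _).comp (continuous_prune X))).norm).div
      ((continuous_gain Lip l _).measurable.comp measurable_fst)

end Measurability

section SignAverages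

variable {ι κ : Type*} [Fintype ι] [Fintype κ] [DecidableEq κ]

lemma sq_intUnits_cast (u : ℤˣ) : ((u : ℤ) : ℝ) ^ 2 = 1 := by
  rcases Int.units_eq_one_or u with h | h <;> simp [h]

lemma expect_signs_mul {a b : κ} (hab : a ≠ b) :
    𝔼 t : κ → ℤˣ, ((t a : ℤ) : ℝ) * (t b : ℤ) = 0 := by
  have flip_sign : 𝔼 t : κ → ℤˣ, ((t a : ℤ) : ℝ) * (t b : ℤ) =
      𝔼 t : κ → ℤˣ, -(((t a : ℤ) : ℝ) * (t b : ℤ)) :=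
    Fintype.expect_equiv (Equiv.mulLeft (Pi.mulSingle a (-1))) _ _ fun t => by
      simp [Pi.mulSingle_eq_of_ne hab.symm]
  rw [Finset.expect_neg_distrib] at flip_sign
  linarith

lemma expect_sq_sum_signs_mul (c : κ → ℝ) :
    𝔼 t : κ → ℤˣ, (∑ j, (t j : ℤ) * c j) ^ 2 = ∑ j, c j ^ 2 := by
  have cross (j k : κ) : 𝔼 t : κ → ℤˣ, ((t j : ℤ) * c j) * ((t k : ℤ) * c k) =
      if j = k then c j ^ 2 else 0 := by
    simp_rw [mul_mul_mul_comm _ (c j)]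
    rw [← Finset.expect_mul]
    split_ifs with h
    · subst h
      simp [← sq, sq_intUnits_cast]
    · rw [expect_signs_mul h, zero_mul]
  simp_rw [sq (∑ _, _), Finset.sum_mul_sum, Finset.expect_sum_comm, cross]
  simp

lemma sum_sq_apply_le_l2_opNorm_sq (A : Matrix ι κ ℝ) (j : κ) : ∑ i, A i j ^ 2 ≤ ‖A‖ ^ 2 := by
  have norm_col_le := norm_toEuclideanLin_apply_le A (EuclideanSpace.single j 1)
  rw [PiLp.norm_single, norm_one, mul_one] at norm_col_le
  have := pow_le_pow_left₀ (norm_nonneg _) norm_col_le 2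
  simpa [EuclideanSpace.real_norm_sq_eq, Matrix.toLpLin_apply] using this

lemma norm_mul_diagonal_signs (A : Matrix ι κ ℝ) (t : κ → ℤˣ) :
    ‖A * Matrix.diagonal fun j => ((t j : ℤ) : ℝ)‖ = ‖A‖ := by
  have norm_le (B : Matrix ι κ ℝ) : ‖B * Matrix.diagonal fun j => ((t j : ℤ) : ℝ)‖ ≤ ‖B‖ := by
    refine (Matrix.l2_opNorm_mul _ _).trans (mul_le_of_le_one_right (norm_nonneg _) ?_)
    rw [Matrix.l2_opNorm_diagonal, pi_norm_le_iff_of_nonneg zero_le_one]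
    intro j
    rcases Int.units_eq_one_or (t j) with h | h <;> simp [h]
  refine (norm_le A).antisymm ?_
  have flip_twice := norm_le (A * Matrix.diagonal fun j => ((t j : ℤ) : ℝ))
  rw [Matrix.mul_assoc, Matrix.diagonal_mul_diagonal] at flip_twice
  simpa only [← sq, sq_intUnits_cast, Matrix.diagonal_one, Matrix.mul_one] using flip_twice

lemma sq_expect_le_expect_sq {τ : Type*} [Fintype τ] [Nonempty τ] (f : τ → ℝ) :
    (𝔼 t, f t) ^ 2 ≤ 𝔼 t, f t ^ 2 := by
  simpa using Finset.expect_mul_sq_le_sq_mul_sq Finset.univ f 1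

/- The spectral norm is not monotone in the absolute values of the entries, but the norms of the
columns are, and only they matter once the signs of the columns are averaged out. -/
lemma expect_norm_mul_diagonal_signs_le {A B : Matrix ι κ ℝ} (h : ∀ i j, |B i j| ≤ |A i j|)
    (v : EuclideanSpace ℝ κ) :
    𝔼 t : κ → ℤˣ, ‖(B * Matrix.diagonal fun j => ((t j : ℤ) : ℝ)).toEuclideanLin v‖ ≤
      ‖A‖ * ‖v‖ := by
  refine le_of_sq_le_sq ((sq_expect_le_expect_sq _).trans ?_) (by positivity)
  calc _ = 𝔼 t : κ → ℤˣ, ∑ i, (∑ j, (t j : ℤ) * (B i j * v j)) ^ 2 := by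
        refine Finset.expect_congr rfl fun t _ => ?_
        rw [EuclideanSpace.real_norm_sq_eq]
        simp only [Matrix.toLpLin_apply, Matrix.mulVec, dotProduct, Matrix.mul_diagonal]
        exact Finset.sum_congr rfl fun i _ => congrArg (· ^ 2)
          (Finset.sum_congr rfl fun j _ => by ring)
    _ = ∑ i, ∑ j, (B i j * v j) ^ 2 := by
        simp_rw [Finset.expect_sum_comm, expect_sq_sum_signs_mul]
    _ = ∑ j, (∑ i, B i j ^ 2) * v j ^ 2 := by
        rw [Finset.sum_comm]
        simp_rw [mul_pow, Finset.sum_mul]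
    _ ≤ ∑ j, (∑ i, A i j ^ 2) * v j ^ 2 := by
        refine Finset.sum_le_sum fun j _ => mul_le_mul_of_nonneg_right ?_ (sq_nonneg _)
        exact Finset.sum_le_sum fun i _ => sq_le_sq.2 (h i j)
    _ ≤ ∑ j, ‖A‖ ^ 2 * v j ^ 2 := by
        gcongr with j
        exact sum_sq_apply_le_l2_opNorm_sq A j
    _ = (‖A‖ * ‖v‖) ^ 2 := by
        rw [mul_pow, EuclideanSpace.real_norm_sq_eq, Finset.mul_sum]

end SignAverages

lemma lintegral_le_lintegral_of_expect_le {Ω τ : Type*} [MeasurableSpace Ω] {μ : Measure Ω}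
    [Fintype τ] [Nonempty τ] {T : τ → Ω → Ω} (hT : ∀ t, MeasurePreserving (T t) μ μ)
    {F G : Ω → ℝ} (hF : Measurable F) (hF0 : ∀ ω, 0 ≤ F ω)
    (h : ∀ ω, 𝔼 t, F (T t ω) ≤ G ω) :
    ∫⁻ ω, ENNReal.ofReal (F ω) ∂μ ≤ ∫⁻ ω, ENNReal.ofReal (G ω) ∂μ := by
  have card_ne_zero : (Fintype.card τ : ℝ≥0∞) ≠ 0 := by simp
  rw [← ENNReal.mul_le_mul_iff_right card_ne_zero (ENNReal.natCast_ne_top _)]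
  calc (Fintype.card τ : ℝ≥0∞) * ∫⁻ ω, ENNReal.ofReal (F ω) ∂μ
      = ∑ t, ∫⁻ ω, ENNReal.ofReal (F (T t ω)) ∂μ := by
        simp_rw [fun t => (hT t).lintegral_comp hF.ennreal_ofReal]
        simp
    _ = ∫⁻ ω, ENNReal.ofReal (∑ t, F (T t ω)) ∂μ := by
        have measurable_comp (t : τ) : Measurable fun ω => ENNReal.ofReal (F (T t ω)) :=
          (hF.comp (hT t).measurable).ennreal_ofReal
        rw [← lintegral_finsetSum _ fun t _ => measurable_comp t]
        simp_rw [ENNReal.ofReal_sum_of_nonneg fun _ _ => hF0 _]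
    _ ≤ ∫⁻ ω, Fintype.card τ * ENNReal.ofReal (G ω) ∂μ := by
        refine lintegral_mono fun ω => ?_
        rw [← ENNReal.ofReal_natCast, ← ENNReal.ofReal_mul (Nat.cast_nonneg _)]
        refine ENNReal.ofReal_le_ofReal ?_
        have := h ω
        rwa [Fintype.expect_eq_sum_div_card, div_le_iff₀' (by positivity)] at this
    _ = Fintype.card τ * ∫⁻ ω, ENNReal.ofReal (G ω) ∂μ :=
        lintegral_const_mul' _ _ (ENNReal.natCast_ne_top _)

section ColumnFlips

variable {L : ℕ} {n : ℕ → ℕ}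

/-- The weights with the signs of the columns of the matrix of each layer `l` changed according to
`t l`. -/
def flipColumns (t : ∀ l : Fin L, Fin (n l) → ℤˣ) (w : Weights L n) : Weights L n :=
  fun e => ((t e.1 e.2.2 : ℤ) : ℝ) * w e

lemma layer_flipColumns (t : ∀ l : Fin L, Fin (n l) → ℤˣ) (w : Weights L n) (l : Fin L) :
    layer (flipColumns t w) l = layer w l * Matrix.diagonal fun j => ((t l j : ℤ) : ℝ) := by
  ext i j
  simp [layer, flipColumns, mul_comm]

lemma norm_layer_flipColumns (t : ∀ l : Fin L, Fin (n l) → ℤˣ) (w : Weights L n) (l : Fin L) :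
    ‖layer (flipColumns t w) l‖ = ‖layer w l‖ := by
  rw [layer_flipColumns, norm_mul_diagonal_signs]

lemma layer_flipColumns_mulSingle_of_ne {k l : Fin L} (h : l ≠ k) (s : Fin (n k) → ℤˣ)
    (w : Weights L n) : layer (flipColumns (Pi.mulSingle k s) w) l = layer w l := by
  simp [layer_flipColumns, Pi.mulSingle_eq_of_ne h]

lemma prune_flipColumns (t : ∀ l : Fin L, Fin (n l) → ℤˣ) (w : Weights L n) (X : Coins L n) :
    prune (flipColumns t w) X = flipColumns t (prune w X) := by
  ext e
  simp only [prune, flipColumns, mul_ite, mul_zero]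

lemma pruneError_flipColumns (t : ∀ l : Fin L, Fin (n l) → ℤˣ) (w : Weights L n) (X : Coins L n)
    (l : Fin L) : pruneError (flipColumns t w) X l =
      pruneError w X l * Matrix.diagonal fun j => ((t l j : ℤ) : ℝ) := by
  rw [pruneError, prune_flipColumns, layer_flipColumns, layer_flipColumns, ← Matrix.sub_mul,
    pruneError]

lemma abs_layer_prune_le (w : Weights L n) (X : Coins L n) (l : Fin L) (i : Fin (n (l + 1)))
    (j : Fin (n l)) : |layer (prune w X) l i j| ≤ |layer w l i j| := by
  simp only [layer, prune, Matrix.of_apply]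
  split_ifs <;> simp

lemma measurePreserving_flipColumns_weightLaw (t : ∀ l : Fin L, Fin (n l) → ℤˣ) (Ψ : ℝ≥0) :
    MeasurePreserving (flipColumns t) (weightLaw L n Ψ) (weightLaw L n Ψ) := by
  refine measurePreserving_pi _ _ fun e => ⟨by fun_prop, ?_⟩
  change (gaussianReal 0 Ψ).map (fun a => ((t e.1 e.2.2 : ℤ) : ℝ) * a) = gaussianReal 0 Ψ
  rcases Int.units_eq_one_or (t e.1 e.2.2) with h | h
  · simp [h]
  · simp [h, gaussianReal_map_neg]

lemma coinLaw_flipColumns (d Ψ : ℝ≥0) (t : ∀ l : Fin L, Fin (n l) → ℤˣ) (w : Weights L n) :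
    coinLaw d Ψ (flipColumns t w) = coinLaw d Ψ w := by
  simp only [coinLaw, pruneProb, flipColumns, mul_pow, sq_intUnits_cast, one_mul]

lemma measurePreserving_flipColumns (d Ψ : ℝ≥0) (t : ∀ l : Fin L, Fin (n l) → ℤˣ) :
    MeasurePreserving (fun p : Weights L n × Coins L n => (flipColumns t p.1, p.2))
      (jointLaw L n d Ψ) (jointLaw L n d Ψ) := by
  have flip_weights := measurePreserving_flipColumns_weightLaw (n := n) t Ψ
  have measurable_flip : Measurable fun p : Weights L n × Coins L n => (flipColumns t p.1, p.2) :=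
    flip_weights.measurable.prodMap measurable_id
  refine ⟨measurable_flip, Measure.ext_of_lintegral _ fun F hF => ?_⟩
  have measurable_comp : Measurable fun p : Weights L n × Coins L n => F (flipColumns t p.1, p.2) :=
    hF.comp measurable_flip
  rw [lintegral_map hF measurable_flip, jointLaw, Measure.lintegral_compProd hF,
    Measure.lintegral_compProd measurable_comp,
    ← flip_weights.lintegral_comp hF.lintegral_kernel_prod_right']
  refine lintegral_congr fun w => ?_
  change ∫⁻ X, F (flipColumns t w, X) ∂coinLaw d Ψ w =
    ∫⁻ X, F (flipColumns t w, X) ∂coinLaw d Ψ (flipColumns t w)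
  rw [coinLaw_flipColumns]

variable {ψ : ∀ l : Fin L, Vec (n (l + 1)) → Vec (n (l + 1))} {Lip : Fin L → ℝ≥0}

lemma act_prune_flipColumns_mulSingle (w : Weights L n) (X : Coins L n) (x : Vec (n 0)) (k : Fin L)
    (s : Fin (n k) → ℤˣ) : act (prune (flipColumns (Pi.mulSingle k s) w) X) ψ x k k.2.le =
      act (prune w X) ψ x k k.2.le := by
  rw [prune_flipColumns]
  exact act_congr x k _ fun j hj => layer_flipColumns_mulSingle_of_ne (Fin.ne_of_lt hj) s _

lemma gain_flipColumns (t : ∀ l : Fin L, Fin (n l) → ℤˣ) (w : Weights L n) (l : ℕ) (hl : l ≤ L) :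
    gain Lip (flipColumns t w) l hl = gain Lip w l hl :=
  gain_congr fun k _ => norm_layer_flipColumns t w k

lemma expect_norm_act_flipColumns_div_gain_le (hψ : ∀ l, LipschitzWith (Lip l) (ψ l))
    (hψ0 : ∀ l, ψ l 0 = 0) (w : Weights L n) (X : Coins L n) (x : Vec (n 0)) (k : Fin L) :
    𝔼 s : Fin (n k) → ℤˣ, ‖act (prune (flipColumns (Pi.mulSingle k s) w) X) ψ x (k + 1) k.2‖ /
        gain Lip (flipColumns (Pi.mulSingle k s) w) (k + 1) k.2 ≤
      ‖act (prune w X) ψ x k k.2.le‖ / gain Lip w k k.2.le := by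
  set u := act (prune w X) ψ x k k.2.le with hu
  have : 0 ≤ gain Lip w k k.2.le := gain_nonneg Lip w k k.2.le
  have cancel_Lip (s : Fin (n k) → ℤˣ) :
      ‖act (prune (flipColumns (Pi.mulSingle k s) w) X) ψ x (k + 1) k.2‖ /
        gain Lip (flipColumns (Pi.mulSingle k s) w) (k + 1) k.2 ≤
      ‖(layer (prune w X) k * Matrix.diagonal fun j => ((s j : ℤ) : ℝ)).toEuclideanLin u‖ /
        (‖layer w k‖ * gain Lip w k k.2.le) := by
    have act_succ := (hψ k).norm_le_mul (hψ0 k)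
      ((layer (prune (flipColumns (Pi.mulSingle k s) w) X) k).toEuclideanLin
        (act (prune (flipColumns (Pi.mulSingle k s) w) X) ψ x k k.2.le))
    rw [act_prune_flipColumns_mulSingle, ← hu] at act_succ
    rw [gain_flipColumns, gain_succ, act, act_prune_flipColumns_mulSingle, ← hu]
    refine (div_le_div_of_nonneg_right act_succ (by positivity)).trans ?_
    rw [prune_flipColumns, layer_flipColumns, Pi.mulSingle_eq_same]
    exact mul_div_mul_left_le (by positivity)
  calc _ ≤ 𝔼 s : Fin (n k) → ℤˣ,
        ‖(layer (prune w X) k * Matrix.diagonal fun j => ((s j : ℤ) : ℝ)).toEuclideanLin u‖ /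
          (‖layer w k‖ * gain Lip w k k.2.le) := Finset.expect_le_expect fun s _ => cancel_Lip s
    _ ≤ ‖layer w k‖ * ‖u‖ / (‖layer w k‖ * gain Lip w k k.2.le) := by
        rw [← Finset.expect_div]
        gcongr
        exact expect_norm_mul_diagonal_signs_le (abs_layer_prune_le w X k) u
    _ ≤ ‖u‖ / gain Lip w k k.2.le := mul_div_mul_left_le (by positivity)

lemma lintegral_norm_pruneError_mul_norm_act_div_gain_le
    (hψ : ∀ l, LipschitzWith (Lip l) (ψ l)) (hψ0 : ∀ l, ψ l 0 = 0) (d Ψ : ℝ≥0) (x : Vec (n 0))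
    (l : Fin L) : ∀ (k : ℕ) (hk : k ≤ L),
      ∫⁻ p, ENNReal.ofReal (‖pruneError p.1 p.2 l‖ *
        (‖act (prune p.1 p.2) ψ x k hk‖ / gain Lip p.1 k hk)) ∂jointLaw L n d Ψ ≤
      ∫⁻ p, ENNReal.ofReal (‖pruneError p.1 p.2 l‖ * ‖x‖) ∂jointLaw L n d Ψ
  | 0, _ => by simp [act, gain_zero]
  | k + 1, hk => by
    refine le_trans ?_
      (lintegral_norm_pruneError_mul_norm_act_div_gain_le hψ hψ0 d Ψ x l k (Nat.le_of_succ_le hk))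
    refine lintegral_le_lintegral_of_expect_le
      (fun s => measurePreserving_flipColumns d Ψ (Pi.mulSingle ⟨k, hk⟩ s))
      ((measurable_norm_pruneError l).mul
        (measurable_norm_act_div_gain (fun l => (hψ l).continuous) Lip x _ hk))
      (fun p => mul_nonneg (norm_nonneg _) (div_nonneg (norm_nonneg _) (gain_nonneg _ _ _ _)))
      fun p => ?_
    simp only [pruneError_flipColumns, norm_mul_diagonal_signs]
    rw [← Finset.mul_expect]
    gcongr
    exact expect_norm_act_flipColumns_div_gain_le hψ hψ0 p.1 p.2 x ⟨k, hk⟩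

lemma lintegral_norm_pruneError_act_div_gain_le (hψ : ∀ l, LipschitzWith (Lip l) (ψ l))
    (hψ0 : ∀ l, ψ l 0 = 0) {d Ψ : ℝ≥0} (hd : 0 < d) (hΨ : 0 < Ψ) {x : Vec (n 0)}
    (hx : ‖x‖ ≤ n 0) (l : Fin L) :
    ∫⁻ p, ENNReal.ofReal (‖(pruneError p.1 p.2 l).toEuclideanLin
        (act (prune p.1 p.2) ψ x l l.2.le)‖ / gain Lip p.1 l l.2.le) ∂jointLaw L n d Ψ ≤
      ENNReal.ofReal (n 0 * Gam 3 d Ψ (n (l + 1)) (n l)) := by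
  calc _ ≤ ∫⁻ p, ENNReal.ofReal (‖pruneError p.1 p.2 l‖ *
        (‖act (prune p.1 p.2) ψ x l l.2.le‖ / gain Lip p.1 l l.2.le)) ∂jointLaw L n d Ψ := by
        refine lintegral_le_lintegral_of_expect_le
          (fun s => measurePreserving_flipColumns d Ψ (Pi.mulSingle l s))
          (measurable_norm_pruneError_act_div_gain (fun l => (hψ l).continuous) Lip x l)
          (fun p => div_nonneg (norm_nonneg _) (gain_nonneg _ _ _ _)) fun p => ?_
        simp only [act_prune_flipColumns_mulSingle, gain_flipColumns, pruneError_flipColumns,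
          Pi.mulSingle_eq_same]
        rw [← Finset.expect_div, ← mul_div_assoc]
        exact div_le_div_of_nonneg_right (expect_norm_mul_diagonal_signs_le (fun _ _ => le_rfl) _)
          (gain_nonneg _ _ _ _)
    _ ≤ ∫⁻ p, ENNReal.ofReal (‖pruneError p.1 p.2 l‖ * ‖x‖) ∂jointLaw L n d Ψ :=
        lintegral_norm_pruneError_mul_norm_act_div_gain_le hψ hψ0 d Ψ x l l l.2.le
    _ ≤ ∫⁻ p, ENNReal.ofReal (n 0) * ENNReal.ofReal ‖pruneError p.1 p.2 l‖ ∂jointLaw L n d Ψ := by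
        refine lintegral_mono fun p => ?_
        rw [← ENNReal.ofReal_mul (Nat.cast_nonneg _), mul_comm]
        gcongr
    _ ≤ ENNReal.ofReal (n 0) * ENNReal.ofReal (Gam 3 d Ψ (n (l + 1)) (n l)) := by
        rw [lintegral_const_mul _ (measurable_norm_pruneError l).ennreal_ofReal]
        gcongr
        exact lintegral_norm_pruneError_le hd hΨ l
    _ = _ := (ENNReal.ofReal_mul (Nat.cast_nonneg _)).symm

end ColumnFlips

section UnionBound

variable {Ω : Type*} [MeasurableSpace Ω] {μ : Measure Ω}

lemma measure_mul_lt_le_inv {Z : Ω → ℝ} (hZ : Measurable Z) {g ε : ℝ} (hg : 0 ≤ g) (hε : 0 < ε)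
    (h : ∫⁻ ω, ENNReal.ofReal (Z ω) ∂μ ≤ ENNReal.ofReal g) :
    μ {ω | ε * g < Z ω} ≤ ENNReal.ofReal ε⁻¹ := by
  rcases hg.eq_or_lt with rfl | hg
  · rw [ENNReal.ofReal_zero, nonpos_iff_eq_zero, lintegral_eq_zero_iff hZ.ennreal_ofReal] at h
    have null : μ {ω | ε * 0 < Z ω} = 0 :=
      measure_mono_null (fun ω hω => by simpa using hω) h
    exact null.trans_le zero_le
  · calc μ {ω | ε * g < Z ω} ≤ μ {ω | ENNReal.ofReal (ε * g) ≤ ENNReal.ofReal (Z ω)} :=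
          measure_mono fun ω hω => ENNReal.ofReal_le_ofReal (le_of_lt hω)
      _ ≤ (∫⁻ ω, ENNReal.ofReal (Z ω) ∂μ) / ENNReal.ofReal (ε * g) :=
          meas_ge_le_lintegral_div hZ.ennreal_ofReal.aemeasurable
            (by simpa using mul_pos hε hg) ENNReal.ofReal_ne_top
      _ ≤ ENNReal.ofReal g / ENNReal.ofReal (ε * g) := ENNReal.div_le_div_right h _
      _ = ENNReal.ofReal ε⁻¹ := by
          rw [← ENNReal.ofReal_div_of_pos (mul_pos hε hg)]
          congr 1
          field_simp

lemma one_sub_sum_inv_le_measureReal {ι : Type*} [Fintype ι] [IsProbabilityMeasure μ]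
    {Z : ι → Ω → ℝ} (hZ : ∀ l, Measurable (Z l)) {g ε : ι → ℝ} (hg : ∀ l, 0 ≤ g l)
    (hε : ∀ l, 0 < ε l) (h : ∀ l, ∫⁻ ω, ENNReal.ofReal (Z l ω) ∂μ ≤ ENNReal.ofReal (g l))
    {S : Set Ω} (hS : ∀ ω, (∀ l, Z l ω ≤ ε l * g l) → ω ∈ S) :
    1 - ∑ l, (ε l)⁻¹ ≤ μ.real S := by
  have cover : (Set.univ : Set Ω) ⊆ S ∪ ⋃ l, {ω | ε l * g l < Z l ω} := by
    intro ω _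
    by_cases hω : ∀ l, Z l ω ≤ ε l * g l
    · exact Or.inl (hS ω hω)
    · push Not at hω
      exact Or.inr (Set.mem_iUnion.2 hω)
  have bad_le : μ.real (⋃ l, {ω | ε l * g l < Z l ω}) ≤ ∑ l, (ε l)⁻¹ :=
    (measureReal_iUnion_fintype_le _).trans (Finset.sum_le_sum fun l _ =>
      ENNReal.toReal_le_of_le_ofReal (inv_pos.2 (hε l)).le
        (measure_mul_lt_le_inv (hZ l) (hg l) (hε l) (h l)))
  have one_le := (measureReal_mono (μ := μ) cover).trans (measureReal_union_le _ _)
  rw [probReal_univ] at one_le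
  linarith

end UnionBound

section PruningBounds

variable {L : ℕ} {n : ℕ → ℕ} {φ : ∀ l : Fin L, Vec (n (l + 1)) → Vec (n (l + 1))}
  {Lip : Fin L → ℝ≥0} {d Ψ : ℝ≥0} {C : ℝ} {ε : Fin L → ℝ} {w : Weights L n} {X : Coins L n}
  {x : Vec (n 0)}

lemma norm_output_sub_output_le_of_div_gain_le
    (hψ : ∀ l, LipschitzWith (Lip l) (withOutputId φ l)) (hψ0 : ∀ l, withOutputId φ l 0 = 0)
    (hC : 0 ≤ C) (hε : ∀ l, 0 ≤ ε l)
    (h : ∀ l : Fin L, ‖(pruneError w X l).toEuclideanLin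
      (act (prune w X) (withOutputId φ) x l l.2.le)‖ / gain Lip w l l.2.le ≤
        ε l * (n 0 * Gam C d Ψ (n (l + 1)) (n l))) :
    ‖output (prune w X) φ x - output w φ x‖ ≤ errorBound C d Ψ ε Lip w := by
  refine norm_output_sub_output_le_errorBound hψ fun l => ?_
  rcases (gain_nonneg Lip w l l.2.le).eq_or_lt with gain_eq_zero | gain_pos
  · rw [act_eq_zero_of_gain_eq_zero hψ hψ0 (fun _ => layer_prune_eq_zero X) x l l.2.le
      gain_eq_zero.symm, ← gain_eq_zero]
    simp
  · have hΓ := Gam_nonneg hC d Ψ (n (l + 1)) (n l)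
    have := hε l
    calc _ ≤ ε l * (n 0 * Gam C d Ψ (n (l + 1)) (n l)) * gain Lip w l l.2.le :=
          (div_le_iff₀ gain_pos).1 (h l)
      _ = 1 * n 0 * (ε l * Gam C d Ψ (n (l + 1)) (n l)) * gain Lip w l l.2.le := by ring
      _ ≤ _ := by
          gcongr
          exact Real.one_le_exp zero_le_one

lemma norm_output_sub_output_le_of_norm_pruneError_le
    (hψ : ∀ l, LipschitzWith (Lip l) (withOutputId φ l)) (hψ0 : ∀ l, withOutputId φ l 0 = 0)
    (hx : ‖x‖ ≤ n 0) (h : ∀ l, ‖pruneError w X l‖ ≤ ε l * Gam C d Ψ (n (l + 1)) (n l))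
    (hΓ : ∀ l : Fin L, ε l * Gam C d Ψ (n (l + 1)) (n l) ≤ 1 / (L : ℝ) * specNorm (layer w l)) :
    ‖output (prune w X) φ x - output w φ x‖ ≤ errorBound C d Ψ ε Lip w := by
  have norm_layer_prune_le (l : Fin L) :
      ‖layer (prune w X) l‖ ≤ (1 + 1 / (L : ℝ)) * ‖layer w l‖ := by
    calc ‖layer (prune w X) l‖ ≤ ‖layer w l‖ + ‖pruneError w X l‖ := norm_le_norm_add_norm_sub _ _
      _ ≤ ‖layer w l‖ + 1 / (L : ℝ) * ‖layer w l‖ := by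
          gcongr
          exact ((h l).trans (hΓ l)).trans_eq (by rw [specNorm_eq_norm])
      _ = _ := by ring
  refine norm_output_sub_output_le_errorBound hψ fun l => ?_
  have := gain_nonneg Lip w l l.2.le
  calc _ ≤ ‖pruneError w X l‖ * ‖act (prune w X) (withOutputId φ) x l l.2.le‖ :=
        norm_toEuclideanLin_apply_le _ _
    _ ≤ ε l * Gam C d Ψ (n (l + 1)) (n l) *
          ((1 + 1 / (L : ℝ)) ^ (l : ℕ) * gain Lip w l l.2.le * ‖x‖) :=
        mul_le_mul (h l) (norm_act_le hψ hψ0 x (by positivity) norm_layer_prune_le l l.2.le)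
          (norm_nonneg _) ((norm_nonneg _).trans (h l))
    _ ≤ ε l * Gam C d Ψ (n (l + 1)) (n l) * (Real.exp 1 * gain Lip w l l.2.le * n 0) := by
        have := (norm_nonneg _).trans (h l)
        gcongr
        exact one_add_inv_pow_le_exp l.2.le
    _ = _ := by ring

end PruningBounds

end MBP

theorem mainTheorem5 :
    ∃ C : ℝ, 0 < C ∧
      ∀ (L : ℕ) (n : ℕ → ℕ) (d Ψ : ℝ≥0), 0 < d → 0 < Ψ →
      ∀ (Lip : Fin L → ℝ≥0) (φ : ∀ l : Fin L, MBP.Vec (n (l + 1)) → MBP.Vec (n (l + 1))),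
        (∀ l : Fin L, (l : ℕ) + 1 < L → LipschitzWith (Lip l) (φ l) ∧ φ l 0 = 0) →
        -- the output layer has no activation, i.e. the identity
        (∀ l : Fin L, (l : ℕ) + 1 = L → 1 ≤ Lip l) →
      ∀ ε : Fin L → ℝ, (∀ l, 0 < ε l) →
        -- for every input of norm at most the input dimension
        (∀ x : MBP.Vec (n 0), ‖x‖ ≤ (n 0 : ℝ) →
          1 - ∑ l, (ε l)⁻¹ ≤ (MBP.jointLaw L n d Ψ).real
            {p | ‖MBP.output (MBP.prune p.1 p.2) φ x - MBP.output p.1 φ x‖ ≤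
              MBP.errorBound C d Ψ ε Lip p.1}) ∧
        -- simultaneously for all such inputs, where the perturbation condition is met
        1 - ∑ l, (ε l)⁻¹ ≤ (MBP.jointLaw L n d Ψ).real
          {p | (∀ l : Fin L, ε l * MBP.Gam C d Ψ (n (l + 1)) (n l) ≤
                  1 / (L : ℝ) * MBP.specNorm (MBP.layer p.1 l)) →
            ∀ x : MBP.Vec (n 0), ‖x‖ ≤ (n 0 : ℝ) →
              ‖MBP.output (MBP.prune p.1 p.2) φ x - MBP.output p.1 φ x‖ ≤
                MBP.errorBound C d Ψ ε Lip p.1} := by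
  refine ⟨3, zero_lt_three, fun L n d Ψ hd hΨ Lip φ hφ hLip ε hε => ?_⟩
  have hψ := MBP.lipschitzWith_withOutputId (fun l hl => (hφ l hl).1) hLip
  have hψ0 := MBP.withOutputId_zero fun l hl => (hφ l hl).2
  have hΓ (l : Fin L) : 0 ≤ MBP.Gam 3 d Ψ (n (l + 1)) (n l) :=
    MBP.Gam_nonneg zero_le_three d Ψ _ _
  constructor
  · intro x hx
    exact MBP.one_sub_sum_inv_le_measureReal
      (MBP.measurable_norm_pruneError_act_div_gain (fun l => (hψ l).continuous) Lip x)
      (fun l => mul_nonneg (Nat.cast_nonneg _) (hΓ l)) hε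
      (MBP.lintegral_norm_pruneError_act_div_gain_le hψ hψ0 hd hΨ hx)
      fun _ error_le => MBP.norm_output_sub_output_le_of_div_gain_le hψ hψ0 zero_le_three
        (fun l => (hε l).le) error_le
  · exact MBP.one_sub_sum_inv_le_measureReal MBP.measurable_norm_pruneError hΓ hε
      (MBP.lintegral_norm_pruneError_le hd hΨ)
      fun _ error_le perturbation_le _ hx =>
        MBP.norm_output_sub_output_le_of_norm_pruneError_le hψ hψ0 hx error_le perturbation_le
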